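/- Let $\{M_p\}_{p\in\mathbb N}$ and $\{A_p\}_{p\in\mathbb N}$ be sequences of positive numbers with $M_0=M_1=A_0=A_1=1$, both satisfying, for some $c_0,H\ge 1$, $(M.1)$ $M_p^2\le M_{p-1}M_{p+1}$ for $p\ge 1$, and $(M.2)$ $M_p\le c_0H^p\min_{0\le q\le p}M_{p-q}M_q$ for $p\ge 0$. Assume moreover $(M.5)$: there are $q>0$ and $c\ge 1$ with $\sum_{j=p+1}^\infty M_{j-1}^q/M_j^q\le c\,p\,M_p^q/M_{p+1}^q$ for all $p\ge 1$; and $(M.6)$: there are $c,L\ge 1$ with $p!\le c\,L^pA_p$ for all $p\ge 0$. Put $A(\rho)=\sup_{p\in\mathbb N}\log^+(\rho^p/A_p)$ for $\rho\ge 0$, and $M_\alpha=M_{|\alpha|}$ for $\alpha\in\mathbb N^d$. For $h>0$ let $\mathcal S^{M_p,h}_{A_p,h}$ be the Banach space of all $\varphi\in C^\infty(\mathbb R^d)$ (complex valued) with $\sigma_h(\varphi)=\sup_{\alpha}h^{|\alpha|}\|e^{A(h|\cdot|)}\partial^\alpha\varphi\|_{L^\infty}/M_\alpha<\infty$. Let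 $\mathcal S^*_\dagger(\mathbb R^d)$ denote either the projective limit $\mathcal S^{(M_p)}_{(A_p)}(\mathbb R^d)$ of these spaces as $h\to\infty$ (Beurling case) or their locally convex inductive limit $\mathcal S^{\{M_p\}}_{\{A_p\}}(\mathbb R^d)$ as $h\to 0$ (Roumieu case), and let $\mathcal S'^*_\dagger(\mathbb R^d)$ be its strong dual, whose elements are called ultradistributions. Translations $T_hf=f(\cdot+h)$ and derivatives $\partial^\alpha f$ of ultradistributions are defined by duality. A complex Banach space $E$ is a translation-invariant Banach space of ultradistributions of class $*-\dagger$ if (I) $\mathcal S^*_\dagger(\mathbb R^d)\subseteq E\subseteq\mathcal S'^*_\dagger(\mathbb R^d)$ with continuous inclusions, the composition being the canonical inclusion, and $\mathcal S^*_\dagger(\mathbb R^d)$ is dense in $E$; (II) $T_h(E)\subseteq E$ for all $h\in\mathbb R^d$; (III) in the Beurling case there are $\tau,C>0$, and in the Roumieu case for every $\tau>0$ there is $C>0$, such that $\|T_{-h}\|_{\mathcal L(E)}\le Ce^{A(\tau|h|)}$ for all $h\in\mathbb R^d$. For such $E$ and $m>0$ let $\mathcal D^{M_p,m}_E=\{\varphi\in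 E:\ \partial^\alpha\varphi\in E\ \text{for all }\alpha\in\mathbb N^d,\ \|\varphi\|_{E,m}=\sup_\alpha m^{|\alpha|}\|\partial^\alpha\varphi\|_E/M_\alpha<\infty\}$, and let $\mathcal D^*_E$ be the projective limit $\mathcal D^{(M_p)}_E$ of these spaces as $m\to\infty$ in the Beurling case, and their locally convex inductive limit $\mathcal D^{\{M_p\}}_E$ as $m\to 0$ in the Roumieu case. For a locally convex space $X$ let $\mathcal L_c(X,X)$ be the space of continuous linear operators on $X$ with the topology of uniform convergence on the compact convex circled subsets of $X$, and regard $X'\otimes X$ as the subspace of finite rank operators. $X$ has the weak approximation property if the identity $\mathrm{Id}$ of $X$ lies in the closure of $X'\otimes X$ in $\mathcal L_c(X,X)$, and the weak sequential approximation property if $\mathrm{Id}$ lies in the sequential closure of $X'\otimes X$, i.e. in the smallest sequentially closed subset of $\mathcal L_c(X,X)$ that contains $X'\otimes X$. A Schauder basis of $E$ is a sequence $(e_n)_{n\ge 1}$ in $E$ such that for each $e\in E$ there is a unique sequence of complex numbers $(t_n)_{n\ge 1}$ with $e=\lim_{n\to\infty}\sum_{j=1}^nt_je_j$. Let $E$ be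 a translation-invariant Banach space of ultradistributions of class $*-\dagger$ (in either the Beurling or the Roumieu case). Then: (i) if $E$ has a Schauder basis, then $\mathcal D^*_E$ has the weak sequential approximation property; (ii) $E$ has the weak approximation property if and only if $\mathcal D^*_E$ has the weak approximation property. -/

import Mathlib

open Filter Topology
open scoped ENNReal NNReal ContDiff

noncomputable section

namespace Ultra

/-! ### Weight sequences -/

/-- A pair of weight sequences `(M_p)`, `(A_p)` with the standing assumptions: both are positive,
normalized, and satisfy `(M.1)` and `(M.2)`; moreover `M_p` satisfies `(M.5)` (some power `M_p ^ q`
is strongly non-quasianalytic) and `A_p` satisfies `(M.6)` (`p! ⊂ A_p`). -/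
structure WeightPair where
  M : ℕ → ℝ
  A : ℕ → ℝ
  M_pos : ∀ p, 0 < M p
  A_pos : ∀ p, 0 < A p
  M_zero : M 0 = 1
  M_one : M 1 = 1
  A_zero : A 0 = 1
  A_one : A 1 = 1
  M_logConvex : ∀ p, 1 ≤ p → M p ^ 2 ≤ M (p - 1) * M (p + 1)
  A_logConvex : ∀ p, 1 ≤ p → A p ^ 2 ≤ A (p - 1) * A (p + 1)
  M_stable : ∃ c₀ H : ℝ, 1 ≤ c₀ ∧ 1 ≤ H ∧
    ∀ p, ∀ q ≤ p, M p ≤ c₀ * H ^ p * (M (p - q) * M q)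
  A_stable : ∃ c₀ H : ℝ, 1 ≤ c₀ ∧ 1 ≤ H ∧
    ∀ p, ∀ q ≤ p, A p ≤ c₀ * H ^ p * (A (p - q) * A q)
  M_power_strongly_nonquasianalytic : ∃ q c₀ : ℝ, 0 < q ∧ 1 ≤ c₀ ∧ ∀ p : ℕ, 1 ≤ p →
    Summable (fun k : ℕ => M (p + k) ^ q / M (p + 1 + k) ^ q) ∧
    ∑' k : ℕ, M (p + k) ^ q / M (p + 1 + k) ^ q ≤ c₀ * p * (M p ^ q / M (p + 1) ^ q)
  factorial_le_A : ∃ c₀ L₀ : ℝ, 1 ≤ c₀ ∧ 1 ≤ L₀ ∧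
    ∀ p : ℕ, (Nat.factorial p : ℝ) ≤ c₀ * L₀ ^ p * A p

/-- The associated function `A(ρ) = sup_p log⁺ (ρ ^ p / A_p)`, `ρ ≥ 0`. -/
def WeightPair.assoc (w : WeightPair) (ρ : ℝ) : ℝ := ⨆ p : ℕ, Real.posLog (ρ ^ p / w.A p)

theorem WeightPair.assoc_mono (w : WeightPair) {ρ ρ' : ℝ} (h0 : 0 ≤ ρ) (h : ρ ≤ ρ') :
    w.assoc ρ ≤ w.assoc ρ' := by
  obtain ⟨c, L, hc, hL, hA⟩ := w.factorial_le_A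
  have h0' : 0 ≤ ρ' := h0.trans h
  apply ciSup_mono
  · refine ⟨Real.posLog (c * Real.exp (L * ρ')), ?_⟩
    rintro _ ⟨p, rfl⟩
    have hp := w.A_pos p
    apply Real.posLog_le_posLog
    · positivity
    · have hf : (0 : ℝ) < Nat.factorial p := by positivity
      have h1 := Real.pow_div_factorial_le_exp (x := L * ρ') (by positivity) p
      rw [div_le_iff₀ hp]
      rw [div_le_iff₀ hf, mul_pow] at h1
      have h2 : L ^ p * ρ' ^ p ≤ Real.exp (L * ρ') * (c * L ^ p * w.A p) :=
        h1.trans (mul_le_mul_of_nonneg_left (hA p) (Real.exp_pos _).le)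
      have hLp : 0 < L ^ p := by positivity
      refine le_of_mul_le_mul_left ?_ hLp
      nlinarith [h2]
  · intro p
    have hp := w.A_pos p
    apply Real.posLog_le_posLog
    · positivity
    · gcongr

/-! ### Beurling and Roumieu limits of a scale of normed spaces -/

/-- `beurling` is the `(M_p)`-`(A_p)` case, `roumieu` is the `{M_p}`-`{A_p}` case. -/
inductive Regime
  | beurling
  | roumieu

/-- A scale of extended norms `‖·‖_h`, `h > 0`, increasing in `h`, on a vector space `W`.
The step `X_h` of the scale is `{x | ‖x‖_h < ∞}`, normed by `‖·‖_h`. -/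
structure NormScale (W : Type*) [AddCommGroup W] [Module ℂ W] where
  norm : ℝ → W → ℝ≥0∞
  norm_zero : ∀ h, 0 < h → norm h 0 = 0
  norm_add_le : ∀ h, 0 < h → ∀ x y, norm h (x + y) ≤ norm h x + norm h y
  norm_smul_le : ∀ h, 0 < h → ∀ (c : ℂ) x, norm h (c • x) ≤ ‖c‖ₑ * norm h x
  norm_mono : ∀ h h', 0 < h → h ≤ h' → ∀ x, norm h x ≤ norm h' x

namespace NormScale

variable {W : Type*} [AddCommGroup W] [Module ℂ W] (N : NormScale W)

theorem add_lt_top {h : ℝ} (hh : 0 < h) {x y : W} (hx : N.norm h x < ⊤) (hy : N.norm h y < ⊤) :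
    N.norm h (x + y) < ⊤ :=
  (N.norm_add_le h hh x y).trans_lt (ENNReal.add_lt_top.2 ⟨hx, hy⟩)

theorem smul_lt_top {h : ℝ} (hh : 0 < h) (c : ℂ) {x : W} (hx : N.norm h x < ⊤) :
    N.norm h (c • x) < ⊤ :=
  (N.norm_smul_le h hh c x).trans_lt (ENNReal.mul_lt_top (by simp) hx)

/-- `⋂_{h > 0} X_h` in the Beurling case and `⋃_{h > 0} X_h` in the Roumieu case. -/
def carrier : Regime → Submodule ℂ W
  | .beurling =>
    { carrier := {x | ∀ h, 0 < h → N.norm h x < ⊤}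
      zero_mem' := fun h hh => by simp [N.norm_zero h hh]
      add_mem' := fun hx hy h hh => N.add_lt_top hh (hx h hh) (hy h hh)
      smul_mem' := fun c _ hx h hh => N.smul_lt_top hh c (hx h hh) }
  | .roumieu =>
    { carrier := {x | ∃ h, 0 < h ∧ N.norm h x < ⊤}
      zero_mem' := ⟨1, one_pos, by simp [N.norm_zero 1 one_pos]⟩
      add_mem' := by
        rintro x y ⟨h, hh, hx⟩ ⟨k, hk, hy⟩
        have hm : 0 < min h k := lt_min hh hk
        exact ⟨min h k, hm, N.add_lt_top hm
          ((N.norm_mono _ _ hm (min_le_left h k) x).trans_lt hx)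
          ((N.norm_mono _ _ hm (min_le_right h k) y).trans_lt hy)⟩
      smul_mem' := by
        rintro c x ⟨h, hh, hx⟩
        exact ⟨h, hh, N.smul_lt_top hh c hx⟩ }

/-- The limit of the scale: the projective limit of the spaces `X_h` as `h → ∞` (Beurling), or
their locally convex inductive limit as `h → 0` (Roumieu). This is a type synonym, so that it
carries only the limit topology defined below and not the one induced by `W`. -/
def Limit (r : Regime) : Type _ := N.carrier r

instance (r : Regime) : AddCommGroup (N.Limit r) := inferInstanceAs (AddCommGroup (N.carrier r))

instance (r : Regime) : Module ℂ (N.Limit r) := inferInstanceAs (Module ℂ (N.carrier r))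

variable {N} in
/-- The underlying element of the ambient vector space. -/
def Limit.val {r : Regime} (x : N.Limit r) : W := Subtype.val (p := fun x => x ∈ N.carrier r) x

/-- The seminorms that define the topology of the limit. Beurling: those dominated by a multiple of
one of the norms `‖·‖_h`, which generate the projective limit topology. Roumieu: those whose
restriction to every step `X_h` is continuous for `‖·‖_h`, which generate the finest locally convex
topology that makes all inclusions `X_h → ⋃_h X_h` continuous. -/
def contSeminorms : (r : Regime) → Set (Seminorm ℂ (N.Limit r))
  | .beurling => {q | ∃ h, 0 < h ∧ ∃ C : ℝ≥0, ∀ x : N.Limit .beurling,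
      ENNReal.ofReal (q x) ≤ C * N.norm h x.val}
  | .roumieu => {q | ∀ h, 0 < h → ∃ C : ℝ≥0, ∀ x : N.Limit .roumieu, N.norm h x.val < ⊤ →
      ENNReal.ofReal (q x) ≤ C * N.norm h x.val}

/-- The family of all seminorms in `contSeminorms`. -/
def seminormFamily (r : Regime) : SeminormFamily ℂ (N.Limit r) (N.contSeminorms r) :=
  fun q => q.1

instance (r : Regime) : Nonempty (N.contSeminorms r) := by
  cases r
  · exact ⟨⟨0, 1, one_pos, 0, fun x => by simp⟩⟩
  · exact ⟨⟨0, fun h _ => ⟨0, fun x _ => by simp⟩⟩⟩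

instance (r : Regime) : TopologicalSpace (N.Limit r) :=
  (N.seminormFamily r).moduleFilterBasis.topology

theorem withSeminorms (r : Regime) : WithSeminorms (N.seminormFamily r) := ⟨rfl⟩

instance (r : Regime) : IsTopologicalAddGroup (N.Limit r) := (N.withSeminorms r).topologicalAddGroup

instance (r : Regime) : ContinuousSMul ℂ (N.Limit r) := (N.withSeminorms r).continuousSMul

end NormScale

/-! ### The Gelfand-Shilov space `S^*_†(ℝ^d)` -/

/-- `ℝ^d` with its Euclidean norm. -/
abbrev Rd (d : ℕ) : Type := EuclideanSpace ℝ (Fin d)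

variable {d : ℕ}

/-- The partial derivative `∂_i f`. -/
def pd (i : Fin d) (f : Rd d → ℂ) : Rd d → ℂ :=
  fun x => fderiv ℝ f x (EuclideanSpace.single i 1)

/-- The order `|α|` of a multi-index. -/
def order (α : Fin d → ℕ) : ℕ := ∑ i, α i

/-- The partial derivative `∂^α f = ∂_1^{α_1} ⋯ ∂_d^{α_d} f`. -/
def mderiv (α : Fin d → ℕ) (f : Rd d → ℂ) : Rd d → ℂ :=
  (List.finRange d).foldr (fun i g => (pd i)^[α i] g) f

/-- The vector space `C^∞(ℝ^d)` of complex valued smooth functions. -/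
def smoothFun (d : ℕ) : Submodule ℂ (Rd d → ℂ) where
  carrier := {f | ContDiff ℝ ∞ f}
  zero_mem' := by
    have h : ContDiff ℝ ∞ (fun _ : Rd d => (0 : ℂ)) := contDiff_const
    exact h
  add_mem' := by
    intro f g hf hg
    have h : ContDiff ℝ ∞ (f + g) := ContDiff.add hf hg
    exact h
  smul_mem' := by
    intro c f hf
    have h : ContDiff ℝ ∞ (c • f) := ContDiff.const_smul c hf
    exact h

theorem pd_smooth (i : Fin d) {f : Rd d → ℂ} (hf : ContDiff ℝ ∞ f) : ContDiff ℝ ∞ (pd i f) := by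
  have h : ContDiff ℝ ∞ (fderiv ℝ f) := hf.fderiv_right (by simp)
  exact h.clm_apply contDiff_const

theorem pd_add (i : Fin d) {f g : Rd d → ℂ} (hf : ContDiff ℝ ∞ f) (hg : ContDiff ℝ ∞ g) :
    pd i (f + g) = pd i f + pd i g := by
  funext x
  have h1 := hf.differentiable (by simp) x
  have h2 := hg.differentiable (by simp) x
  simp [pd, fderiv_add h1 h2]

theorem pd_smul (i : Fin d) (c : ℂ) {f : Rd d → ℂ} (hf : ContDiff ℝ ∞ f) :
    pd i (c • f) = c • pd i f := by
  funext x
  have h1 := hf.differentiable (by simp) x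
  simp [pd, fderiv_const_smul h1 c]

theorem pd_iter (i : Fin d) (n : ℕ) {f g : Rd d → ℂ} (c : ℂ) (hf : ContDiff ℝ ∞ f)
    (hg : ContDiff ℝ ∞ g) : ContDiff ℝ ∞ ((pd i)^[n] f) ∧
      (pd i)^[n] (f + g) = (pd i)^[n] f + (pd i)^[n] g ∧
      (pd i)^[n] (c • f) = c • (pd i)^[n] f := by
  induction n generalizing f g with
  | zero => exact ⟨hf, rfl, rfl⟩
  | succ n ih =>
    simp only [Function.iterate_succ_apply]
    rw [pd_add i hf hg, pd_smul i c hf]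
    exact ih (pd_smooth i hf) (pd_smooth i hg)

theorem mderiv_linear (α : Fin d → ℕ) {f g : Rd d → ℂ} (c : ℂ) (hf : ContDiff ℝ ∞ f)
    (hg : ContDiff ℝ ∞ g) : mderiv α (f + g) = mderiv α f + mderiv α g ∧
      mderiv α (c • f) = c • mderiv α f := by
  have key : ∀ l : List (Fin d), ∀ {f g : Rd d → ℂ}, ContDiff ℝ ∞ f → ContDiff ℝ ∞ g →
      ContDiff ℝ ∞ (l.foldr (fun i g => (pd i)^[α i] g) f) ∧
      l.foldr (fun i g => (pd i)^[α i] g) (f + g) =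
        l.foldr (fun i g => (pd i)^[α i] g) f + l.foldr (fun i g => (pd i)^[α i] g) g ∧
      l.foldr (fun i g => (pd i)^[α i] g) (c • f) =
        c • l.foldr (fun i g => (pd i)^[α i] g) f := by
    intro l
    induction l with
    | nil => intro f g hf hg; exact ⟨hf, rfl, rfl⟩
    | cons i l ih =>
      intro f g hf hg
      obtain ⟨h1, h2, h3⟩ := ih hf hg
      obtain ⟨k1, -, -⟩ := ih hg hf
      simp only [List.foldr_cons]
      rw [h2, h3]
      exact pd_iter i (α i) c h1 k1
  exact (key _ hf hg).2

/-- The norm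
`σ_h(φ) = sup_α sup_x h^{|α|} e^{A(h|x|)} |∂^α φ(x)| / M_{|α|}` on smooth functions. (The usual
factor `i^{-|α|}` in the symbol `D^α` has modulus one and is dropped.) -/
def gsNorm (w : WeightPair) (h : ℝ) (φ : smoothFun d) : ℝ≥0∞ :=
  ⨆ (α : Fin d → ℕ) (x : Rd d), ENNReal.ofReal
    (h ^ order α * Real.exp (w.assoc (h * ‖x‖)) * ‖mderiv α φ.1 x‖ / w.M (order α))

/-- The scale of the Banach spaces `S^{M_p,h}_{A_p,h}`, `h > 0`. -/
def gsScale (w : WeightPair) (d : ℕ) : NormScale (smoothFun d) where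
  norm := gsNorm w
  norm_zero := fun h _ => by
    have h0 : ∀ α : Fin d → ℕ, mderiv α (0 : Rd d → ℂ) = 0 := fun α => by
      have := (mderiv_linear α (f := (0 : Rd d → ℂ)) (g := 0) 0 contDiff_const contDiff_const).2
      simpa using this
    simp [gsNorm, h0]
  norm_add_le := fun h hh φ ψ => by
    refine iSup₂_le fun α x => ?_
    have hM := w.M_pos (order α)
    refine le_trans ?_ (add_le_add
      (le_iSup₂ (f := fun (α : Fin d → ℕ) (x : Rd d) => ENNReal.ofReal
        (h ^ order α * Real.exp (w.assoc (h * ‖x‖)) * ‖mderiv α φ.1 x‖ / w.M (order α))) α x)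
      (le_iSup₂ (f := fun (α : Fin d → ℕ) (x : Rd d) => ENNReal.ofReal
        (h ^ order α * Real.exp (w.assoc (h * ‖x‖)) * ‖mderiv α ψ.1 x‖ / w.M (order α))) α x))
    rw [← ENNReal.ofReal_add (by positivity) (by positivity), ← add_div, ← mul_add]
    apply ENNReal.ofReal_le_ofReal
    have e : mderiv α (φ + ψ).1 = mderiv α φ.1 + mderiv α ψ.1 :=
      (mderiv_linear α 0 φ.2 ψ.2).1
    rw [e]
    gcongr
    exact norm_add_le _ _
  norm_smul_le := fun h hh c φ => by
    refine iSup₂_le fun α x => ?_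
    have hM := w.M_pos (order α)
    refine le_trans ?_ (mul_le_mul_right
      (le_iSup₂ (f := fun (α : Fin d → ℕ) (x : Rd d) => ENNReal.ofReal
        (h ^ order α * Real.exp (w.assoc (h * ‖x‖)) * ‖mderiv α φ.1 x‖ / w.M (order α))) α x) _)
    rw [← ofReal_norm, ← ENNReal.ofReal_mul (norm_nonneg c)]
    apply ENNReal.ofReal_le_ofReal
    have e : mderiv α (c • φ).1 = c • mderiv α φ.1 := (mderiv_linear α c φ.2 φ.2).2
    rw [e, Pi.smul_apply, norm_smul]
    apply le_of_eq
    ring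
  norm_mono := fun h h' hh hle φ => by
    refine iSup₂_mono fun α x => ENNReal.ofReal_le_ofReal ?_
    have hM := w.M_pos (order α)
    have hA : w.assoc (h * ‖x‖) ≤ w.assoc (h' * ‖x‖) :=
      w.assoc_mono (by positivity) (by gcongr)
    have hh' : 0 < h' := hh.trans_le hle
    gcongr

/-- The space `S^*_†(ℝ^d)`: the Fréchet space `S^{(M_p)}_{(A_p)}(ℝ^d)` in the Beurling case, the
inductive limit `S^{{M_p}}_{{A_p}}(ℝ^d)` in the Roumieu case. -/
abbrev TestSpace (r : Regime) (w : WeightPair) (d : ℕ) : Type := (gsScale w d).Limit r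

/-- A test function viewed as a function on `ℝ^d`. -/
def TestSpace.toFun {r : Regime} {w : WeightPair} (φ : TestSpace r w d) : Rd d → ℂ := φ.val.1

/-- The space `S'^*_†(ℝ^d)` of ultradistributions, with the strong dual topology. -/
abbrev UltraDist (r : Regime) (w : WeightPair) (d : ℕ) : Type := TestSpace r w d →L[ℂ] ℂ

variable {r : Regime} {w : WeightPair}

/-- `g = ∂^α f` for ultradistributions: `⟨g, φ⟩ = (-1)^{|α|} ⟨f, ∂^α φ⟩` for all test functions
`φ`; here `ψ` is the test function `∂^α φ`. -/
def IsDeriv (α : Fin d → ℕ) (f g : UltraDist r w d) : Prop :=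
  ∀ φ ψ : TestSpace r w d, ψ.toFun = mderiv α φ.toFun → g φ = (-1) ^ order α * f ψ

/-- `g = T_h f = f(· + h)` for ultradistributions: `⟨g, φ⟩ = ⟨f, φ(· - h)⟩` for all test functions
`φ`; here `ψ` is the test function `φ(· - h)`. -/
def IsTranslate (h : Rd d) (f g : UltraDist r w d) : Prop :=
  ∀ φ ψ : TestSpace r w d, ψ.toFun = (fun x => φ.toFun (x - h)) → g φ = f ψ

/-! ### Translation-invariant Banach spaces of ultradistributions -/

/-- `E` (with these inclusions, and assumed to be complete) is a translation-invariant Banach space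
of ultradistributions of class `* - †`. -/
structure TranslationInvariant (r : Regime) (w : WeightPair) (d : ℕ) (E : Type*)
    [NormedAddCommGroup E] [NormedSpace ℂ E] where
  /-- the continuous inclusion of `S^*_†` in `E` -/
  ofTest : TestSpace r w d →L[ℂ] E
  /-- the continuous inclusion of `E` in `S'^*_†` -/
  toUltra : E →L[ℂ] UltraDist r w d
  toUltra_injective : Function.Injective toUltra
  denseRange_ofTest : DenseRange ofTest
  /-- the composition of the two is the usual inclusion of `S^*_†` in `S'^*_†` -/
  toUltra_ofTest : ∀ φ ψ : TestSpace r w d,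
    toUltra (ofTest φ) ψ = ∫ x : Rd d, φ.toFun x * ψ.toFun x
  /-- `T_h E ⊆ E` for all `h` -/
  exists_translate : ∀ (h : Rd d) (e : E), ∃ g : E, IsTranslate h (toUltra e) (toUltra g)
  /-- `‖T_{-h}‖ ≤ C e^{A(τ|h|)}`, for some `τ` (Beurling), for all `τ` (Roumieu) -/
  growth : match r with
    | .beurling => ∃ τ C : ℝ, 0 < τ ∧ 0 < C ∧ ∀ (h : Rd d) (e g : E),
        IsTranslate (-h) (toUltra e) (toUltra g) →
          ‖g‖ ≤ C * Real.exp (w.assoc (τ * ‖h‖)) * ‖e‖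
    | .roumieu => ∀ τ : ℝ, 0 < τ → ∃ C : ℝ, 0 < C ∧ ∀ (h : Rd d) (e g : E),
        IsTranslate (-h) (toUltra e) (toUltra g) →
          ‖g‖ ≤ C * Real.exp (w.assoc (τ * ‖h‖)) * ‖e‖

namespace TranslationInvariant

variable {E : Type*} [NormedAddCommGroup E] [NormedSpace ℂ E] (T : TranslationInvariant r w d E)

/-- The norm `‖e‖_{E,m} = sup_α m^{|α|} ‖∂^α e‖_E / M_{|α|}`, where `∂^α e` is taken in the sense of
ultradistributions; it is `∞` if some `∂^α e` is not in `E`. The infimum is over all `g ∈ E` with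
`g = ∂^α e`; there is at most one such `g`. -/
def derivNorm (m : ℝ) (e : E) : ℝ≥0∞ :=
  ⨆ α : Fin d → ℕ, ⨅ g : {g : E // IsDeriv α (T.toUltra e) (T.toUltra g)},
    ENNReal.ofReal (m ^ order α * ‖g.1‖ / w.M (order α))

/-- The scale of the Banach spaces `D^{M_p,m}_E`, `m > 0`. -/
def derivScale : NormScale E where
  norm := T.derivNorm
  norm_zero := fun m _ => by
    refine le_antisymm (iSup_le fun α => ?_) bot_le
    refine iInf_le_of_le ⟨0, fun φ ψ _ => by simp⟩ (by simp)
  norm_add_le := fun m hm a b => by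
    refine iSup_le fun α => ?_
    have hM := w.M_pos (order α)
    refine le_trans ?_ (add_le_add (le_iSup (fun α : Fin d → ℕ =>
        ⨅ g : {g : E // IsDeriv α (T.toUltra a) (T.toUltra g)},
          ENNReal.ofReal (m ^ order α * ‖g.1‖ / w.M (order α))) α)
      (le_iSup (fun α : Fin d → ℕ =>
        ⨅ g : {g : E // IsDeriv α (T.toUltra b) (T.toUltra g)},
          ENNReal.ofReal (m ^ order α * ‖g.1‖ / w.M (order α))) α))
    simp only [ENNReal.iInf_add, ENNReal.add_iInf]
    refine le_iInf₂ fun g k => ?_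
    refine iInf_le_of_le ⟨k.1 + g.1, fun φ ψ h => ?_⟩ ?_
    · have h1 := g.2 φ ψ h
      have h2 := k.2 φ ψ h
      simp [map_add, h1, h2, mul_add]
    · rw [← ENNReal.ofReal_add (by positivity) (by positivity), ← add_div, ← mul_add]
      apply ENNReal.ofReal_le_ofReal
      gcongr
      exact norm_add_le _ _
  norm_smul_le := fun m hm c e => by
    rcases eq_or_ne c 0 with rfl | hc
    · refine iSup_le fun α => ?_
      refine iInf_le_of_le ⟨0, fun φ ψ _ => by simp⟩ (by simp)
    refine iSup_le fun α => ?_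
    have hM := w.M_pos (order α)
    refine le_trans ?_ (mul_le_mul_right (le_iSup (fun α : Fin d → ℕ =>
        ⨅ g : {g : E // IsDeriv α (T.toUltra e) (T.toUltra g)},
          ENNReal.ofReal (m ^ order α * ‖g.1‖ / w.M (order α))) α) _)
    rw [ENNReal.mul_iInf_of_ne (by simpa using hc) (by simp)]
    refine le_iInf fun g => ?_
    refine iInf_le_of_le ⟨c • g.1, fun φ ψ h => ?_⟩ ?_
    · have h1 := g.2 φ ψ h
      simp only [map_smul, smul_apply, h1, smul_eq_mul]
      ring
    · rw [← ofReal_norm, ← ENNReal.ofReal_mul (norm_nonneg c), norm_smul]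
      apply ENNReal.ofReal_le_ofReal
      apply le_of_eq
      ring
  norm_mono := fun m m' hm hle e => by
    refine iSup_mono fun α => iInf_mono fun g => ENNReal.ofReal_le_ofReal ?_
    have hM := w.M_pos (order α)
    gcongr

/-- The test function space `D^*_E`: the projective limit `D^{(M_p)}_E` of the spaces
`D^{M_p,m}_E` as `m → ∞` in the Beurling case, their inductive limit `D^{{M_p}}_E` as `m → 0` in the
Roumieu case. -/
abbrev D {r : Regime} {w : WeightPair} {d : ℕ} {E : Type*} [NormedAddCommGroup E] [NormedSpace ℂ E]
    (T : TranslationInvariant r w d E) : Type _ := T.derivScale.Limit r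

end TranslationInvariant

/-! ### Schauder bases and approximation properties -/

/-- `E` has a Schauder basis: a sequence `(b_n)` such that every `e ∈ E` has a unique expansion
`e = ∑ t_n b_n` with complex coefficients, converging as a sequence of partial sums. -/
def HasSchauderBasis (E : Type*) [NormedAddCommGroup E] [NormedSpace ℂ E] : Prop :=
  ∃ b : ℕ → E, ∀ e : E, ∃! t : ℕ → ℂ,
    Tendsto (fun n => ∑ j ∈ Finset.range n, t j • b j) atTop (𝓝 e)

section Approximation

variable (X : Type*) [AddCommGroup X] [Module ℂ X] [TopologicalSpace X] [IsTopologicalAddGroup X]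
  [ContinuousSMul ℂ X]

/-- `L_c(X, X)`: the continuous linear operators on `X` with the topology of uniform convergence on
the compact convex circled subsets of `X`. -/
abbrev Lc : Type _ :=
  UniformConvergenceCLM (RingHom.id ℂ) X {K : Set X | IsCompact K ∧ Convex ℝ K ∧ Balanced ℂ K}

/-- The identity operator in `L_c(X, X)`. -/
def Lc.id : Lc X := ContinuousLinearMap.id ℂ X

/-- The rank one operator `x' ⊗ x : y ↦ ⟨x', y⟩ x` in `L_c(X, X)`. -/
def Lc.rankOne {X : Type*} [AddCommGroup X] [Module ℂ X] [TopologicalSpace X]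
    [IsTopologicalAddGroup X] [ContinuousSMul ℂ X] (f : X →L[ℂ] ℂ) (x : X) : Lc X :=
  ContinuousLinearMap.smulRight f x

/-- `X' ⊗ X`, as a subspace of `L_c(X, X)`. -/
def finiteRank : Submodule ℂ (Lc X) :=
  Submodule.span ℂ (Set.range fun p : (X →L[ℂ] ℂ) × X => Lc.rankOne p.1 p.2)

/-- The identity is in the closure of `X' ⊗ X` in `L_c(X, X)`. -/
def WeakApproximationProperty : Prop := Lc.id X ∈ closure (finiteRank X : Set (Lc X))

/-- The identity is in the sequential closure of `X' ⊗ X` in `L_c(X, X)`, that is, in the smallest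
sequentially closed set that contains `X' ⊗ X`. -/
def WeakSequentialApproximationProperty : Prop :=
  Lc.id X ∈ ⋂₀ {F : Set (Lc X) | (finiteRank X : Set (Lc X)) ⊆ F ∧ IsSeqClosed F}

end Approximation

end Ultra

end

noncomputable section

namespace Ultra

/-! ### Approximation properties and factorization -/

section Transfer

set_option linter.unusedSectionVars false

variable {X Y : Type*} [AddCommGroup X] [Module ℂ X] [TopologicalSpace X]
  [IsTopologicalAddGroup X] [ContinuousSMul ℂ X] [AddCommGroup Y] [Module ℂ Y]
  [TopologicalSpace Y] [IsTopologicalAddGroup Y] [ContinuousSMul ℂ Y]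

/-! Regularization makes each of `E` and `D^*_E` factor approximately through the other. Take a test
function `φ` with integral `1`, let `ε_n = 1/(n+1)`, let `J` be the inclusion of `D^*_E` in `E`, and
put `S_n e = ∫ φ(y) e(· - ε_n y) dy`. Then `S_n` is continuous from `E` to `D^*_E`, and both `S_n J
→ Id` on `D^*_E` and `J S_n → Id` on `E`, uniformly on compact sets (`exists_regularization`).

Given this, an operator `F` of finite rank on `E` that is close to the identity on `J(K)` yields the
finite rank operator `S_n F J`, close to the identity on `K`; exchanging the roles of `S_n` and `J`
gives the converse, whence (ii). If `E` has a Schauder basis, its partial sum operators `P_k`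
converge to `Id` in `L_c(E, E)` (`HasSchauderBasis.exists_finiteRank_tendsto`), and `Id = lim_n
lim_k S_n P_k J` is an iterated sequential limit of finite rank operators, whence (i).

The integral converges in `E` because the decay of `φ` beats the growth of the translations
(`exists_growth`). In the Beurling case `φ` decays at every rate; in the Roumieu case it decays at
some rate, and the growth rate is chosen afterwards. An integrable factor is left over thanks to
(M.2) for `A_p`. Derivatives may fall on the kernel, `∂^α(S_n e) = ε_n^{-|α|} ∫ (∂^α φ)(y) e(· - ε_n
y) dy` (`isDeriv_reg`), which gives `S_n : E → D^*_E`. They may also fall on `e`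
(`isDeriv_reg_reg`), which gives bounds for `S_n J` on every step that do not depend on `n`.
Pointwise convergence comes from the strong continuity of translations on `E`, and equicontinuity
upgrades it to uniform convergence on compact sets.

If there are no nonzero test functions, then density forces `E = 0` and there is nothing to
approximate. -/

theorem image_compact_convex_balanced (a : X →L[ℂ] Y) {K : Set X}
    (hK : IsCompact K ∧ Convex ℝ K ∧ Balanced ℂ K) :
    IsCompact (a '' K) ∧ Convex ℝ (a '' K) ∧ Balanced ℂ (a '' K) := by
  refine ⟨hK.1.image a.continuous, hK.2.1.linear_image (a.restrictScalars ℝ).toLinearMap, ?_⟩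
  rintro c hc _ ⟨_, ⟨x, hx, rfl⟩, rfl⟩
  exact ⟨c • x, hK.2.2 c hc ⟨x, hx, rfl⟩, map_smul a c x⟩

-- `K + L` contains both sets because a nonempty balanced set contains `0`; this is why empty sets
-- are treated apart. Directedness is what gives `L_c(X, X)` a neighbourhood basis indexed by single
-- pairs `(K, V)`.
open scoped Pointwise in
theorem directedOn_compact_convex_balanced :
    DirectedOn (· ⊆ ·) {K : Set X | IsCompact K ∧ Convex ℝ K ∧ Balanced ℂ K} := by
  intro K hK L hL
  rcases K.eq_empty_or_nonempty with rfl | hKn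
  · exact ⟨L, hL, Set.empty_subset _, subset_rfl⟩
  rcases L.eq_empty_or_nonempty with rfl | hLn
  · exact ⟨K, hK, subset_rfl, Set.empty_subset _⟩
  refine ⟨K + L, ⟨hK.1.add hL.1, hK.2.1.add hL.2.1, hK.2.2.add hL.2.2⟩, ?_, ?_⟩
  · intro x hx
    exact ⟨x, hx, 0, hL.2.2.zero_mem hLn, add_zero x⟩
  · intro x hx
    exact ⟨0, hK.2.2.zero_mem hKn, x, hx, zero_add x⟩

theorem Lc.tendsto_iff {ι : Type*} {l : Filter ι} {A : ι → Lc X} {B : Lc X} :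
    Tendsto A l (𝓝 B) ↔ ∀ K : Set X, IsCompact K ∧ Convex ℝ K ∧ Balanced ℂ K →
      ∀ V ∈ 𝓝 (0 : X), ∀ᶠ i in l, ∀ x ∈ K, A i x - B x ∈ V := by
  rw [← tendsto_sub_nhds_zero_iff, UniformConvergenceCLM.nhds_zero_eq]
  simp only [tendsto_iInf, tendsto_principal]
  rfl

theorem Lc.id_mem_closure_iff {S : Set (Lc X)} :
    Lc.id X ∈ closure S ↔ ∀ K : Set X, IsCompact K ∧ Convex ℝ K ∧ Balanced ℂ K →
      ∀ V ∈ 𝓝 (0 : X), ∃ F ∈ S, ∀ x ∈ K, F x - x ∈ V := by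
  have hne : {K : Set X | IsCompact K ∧ Convex ℝ K ∧ Balanced ℂ K}.Nonempty :=
    ⟨∅, isCompact_empty, convex_empty, balanced_empty⟩
  have hb := (UniformConvergenceCLM.hasBasis_nhds_zero (RingHom.id ℂ) X _ hne
    directedOn_compact_convex_balanced).map (Lc.id X + ·)
  rw [map_add_left_nhds_zero] at hb
  rw [mem_closure_iff_nhds_basis hb]
  constructor
  · intro h K hK V hV
    obtain ⟨F, hF, G, hG, rfl⟩ := h (K, V) ⟨hK, hV⟩
    refine ⟨_, hF, fun x hx => ?_⟩
    have : (Lc.id X + G) x - x = G x := by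
      change x + G x - x = G x
      abel
    rw [this]
    exact hG x hx
  · rintro h ⟨K, V⟩ ⟨hK, hV⟩
    obtain ⟨F, hF, hFK⟩ := h K hK V hV
    exact ⟨F, hF, F - Lc.id X, hFK, add_sub_cancel _ _⟩

/-- The operator `b ∘ F ∘ a`, for an operator `F` on `Y`. -/
def Lc.sandwich (a : X →L[ℂ] Y) (b : Y →L[ℂ] X) (F : Lc Y) : Lc X :=
  b.comp (ContinuousLinearMap.comp (show Y →L[ℂ] Y from F) a)

theorem Lc.sandwich_mem_finiteRank (a : X →L[ℂ] Y) (b : Y →L[ℂ] X) {F : Lc Y}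
    (hF : F ∈ finiteRank Y) : Lc.sandwich a b F ∈ finiteRank X := by
  refine Submodule.span_induction (p := fun F _ => Lc.sandwich a b F ∈ finiteRank X)
    ?_ ?_ ?_ ?_ hF
  · rintro _ ⟨⟨f, y⟩, rfl⟩
    refine Submodule.subset_span ⟨(f.comp a, b y), ?_⟩
    apply UniformConvergenceCLM.ext
    intro x
    exact (map_smul b (f (a x)) y).symm
  · have : Lc.sandwich a b (0 : Lc Y) = 0 := by
      apply UniformConvergenceCLM.ext
      intro x
      exact map_zero b
    rw [this]
    exact zero_mem _
  · intro F G _ _ hF hG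
    have : Lc.sandwich a b (F + G) = Lc.sandwich a b F + Lc.sandwich a b G := by
      apply UniformConvergenceCLM.ext
      intro x
      exact map_add b _ _
    rw [this]
    exact add_mem hF hG
  · intro c F _ hF
    have : Lc.sandwich a b (c • F) = c • Lc.sandwich a b F := by
      apply UniformConvergenceCLM.ext
      intro x
      exact map_smul b _ _
    rw [this]
    exact Submodule.smul_mem _ _ hF

theorem Lc.tendsto_sandwich {ι : Type*} {l : Filter ι} (a : X →L[ℂ] Y) (b : Y →L[ℂ] X)
    {F : ι → Lc Y} {G : Lc Y} (h : Tendsto F l (𝓝 G)) :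
    Tendsto (fun i => Lc.sandwich a b (F i)) l (𝓝 (Lc.sandwich a b G)) := by
  rw [Lc.tendsto_iff] at h ⊢
  intro K hK V hV
  have hV' : b ⁻¹' V ∈ 𝓝 (0 : Y) := b.continuous.continuousAt.preimage_mem_nhds (by simpa using hV)
  filter_upwards [h _ (image_compact_convex_balanced a hK) _ hV'] with i hi x hx
  have := hi (a x) ⟨x, hx, rfl⟩
  rwa [Set.mem_preimage, map_sub] at this

/-- If the identity of `X` is approximately factored through `Y`, then the weak approximation
property passes from `Y` to `X`. -/
theorem WeakApproximationProperty.of_approx_factor {a : ℕ → X →L[ℂ] Y} {b : ℕ → Y →L[ℂ] X}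
    (h : Tendsto (fun n => Lc.sandwich (a n) (b n) (Lc.id Y)) atTop (𝓝 (Lc.id X)))
    (hY : WeakApproximationProperty Y) : WeakApproximationProperty X := by
  rw [WeakApproximationProperty, Lc.id_mem_closure_iff] at hY ⊢
  rw [Lc.tendsto_iff] at h
  intro K hK V hV
  obtain ⟨U, hU, hUV⟩ := exists_nhds_zero_half hV
  obtain ⟨n, hn⟩ := (h K hK U hU).exists
  have hU' : b n ⁻¹' U ∈ 𝓝 (0 : Y) :=
    (b n).continuous.continuousAt.preimage_mem_nhds (by simpa using hU)
  -- Since `n` is already fixed, `F` has to be good only on the one compact set `a n '' K`, with an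
  -- error in the preimage of `U` under `b n`; no uniformity in `n` is needed.
  obtain ⟨F, hF, hFK⟩ := hY _ (image_compact_convex_balanced (a n) hK) _ hU'
  refine ⟨Lc.sandwich (a n) (b n) F, Lc.sandwich_mem_finiteRank _ _ hF, fun x hx => ?_⟩
  have h1 := hFK (a n x) ⟨x, hx, rfl⟩
  have h2 : b n (a n x) - x ∈ U := hn x hx
  rw [Set.mem_preimage, map_sub] at h1
  have := hUV _ h1 _ h2
  rwa [sub_add_sub_cancel] at this

/-- An iterated limit, in `k` for fixed `n` and then in `n`. The smallest sequentially closed set is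
stable under such limits, so no diagonal sequence has to be extracted. -/
theorem WeakSequentialApproximationProperty.of_approx_factor {a : ℕ → X →L[ℂ] Y}
    {b : ℕ → Y →L[ℂ] X}
    (h : Tendsto (fun n => Lc.sandwich (a n) (b n) (Lc.id Y)) atTop (𝓝 (Lc.id X)))
    {P : ℕ → Lc Y} (hP : ∀ k, P k ∈ finiteRank Y) (hPid : Tendsto P atTop (𝓝 (Lc.id Y))) :
    WeakSequentialApproximationProperty X := by
  rintro S ⟨hS, hSc⟩
  exact hSc (fun n => hSc (fun k => hS (Lc.sandwich_mem_finiteRank (a n) (b n) (hP k)))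
    (Lc.tendsto_sandwich (a n) (b n) hPid)) h

/-- An equicontinuous sequence of operators which converges pointwise to the identity converges
uniformly on compact sets. -/
theorem Lc.tendsto_id_of_pointwise {ι : Type*} [Nonempty ι] {Q : SeminormFamily ℂ X ι}
    (hQ : WithSeminorms Q) {A : ℕ → Lc X}
    (hA : ∀ q : Seminorm ℂ X, Continuous q →
      ∃ p : Seminorm ℂ X, Continuous p ∧ ∀ n x, q (A n x) ≤ p x)
    (hlim : ∀ x, Tendsto (fun n => A n x) atTop (𝓝 x)) :
    Tendsto A atTop (𝓝 (Lc.id X)) := by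
  rw [Lc.tendsto_iff]
  intro K hK V hV
  obtain ⟨s, ε, hε, hsV⟩ := (hQ.mem_nhds_iff 0 V).1 hV
  set q : Seminorm ℂ X := s.sup fun i => Q i with hq
  have hqc : Continuous q := by
    refine Seminorm.continuous (r := 1) ?_
    exact (hQ.mem_nhds_iff 0 _).2 ⟨s, 1, one_pos, subset_rfl⟩
  obtain ⟨p, hp, hpA⟩ := hA q hqc
  -- The covering is measured in `p + q`: `p` controls `A n (x - y)` uniformly in `n`, and `q`
  -- controls `y - x`. Together they use `ε / 2`, and the finitely many centres use the other `ε /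
  -- 2`.
  have hc : ∀ y ∈ K, {x | p (x - y) + q (x - y) < ε / 2} ∈ 𝓝[K] y := by
    intro y _
    refine mem_nhdsWithin_of_mem_nhds (IsOpen.mem_nhds ?_ (by simpa using half_pos hε))
    exact isOpen_lt (by fun_prop) continuous_const
  obtain ⟨t, htK, ht⟩ := hK.1.elim_nhdsWithin_subcover _ hc
  have hev : ∀ᶠ n in atTop, ∀ y ∈ t, q (A n y - y) < ε / 2 := by
    rw [Filter.eventually_all_finset]
    intro y _
    have h1 : Tendsto (fun n => q (A n y - y)) atTop (𝓝 (q (y - y))) :=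
      (hqc.tendsto _).comp ((hlim y).sub_const y)
    rw [sub_self, map_zero] at h1
    exact h1.eventually_lt_const (half_pos hε)
  filter_upwards [hev] with n hn x hx
  refine hsV ?_
  rw [Seminorm.mem_ball_zero]
  obtain ⟨y, hyt, hy⟩ := Set.mem_iUnion₂.1 (ht hx)
  have e : A n x - Lc.id X x = A n (x - y) + (A n y - y) + (y - x) := by
    rw [map_sub]
    change A n x - x = _
    abel
  have h1 := hpA n (x - y)
  have h2 := hn y hyt
  have h3 : q (y - x) = q (x - y) := map_sub_rev q y x
  have h4 : p (x - y) + q (x - y) < ε / 2 := hy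
  calc q (A n x - Lc.id X x) ≤ q (A n (x - y)) + q (A n y - y) + q (y - x) := by
        rw [e]
        exact (map_add_le_add q _ _).trans (add_le_add_left (map_add_le_add q _ _) _)
    _ < ε := by linarith

end Transfer

theorem Lc.tendsto_id_of_norm_le {E : Type*} [NormedAddCommGroup E] [NormedSpace ℂ E]
    {A : ℕ → Lc E} {C : ℝ} (hA : ∀ n x, ‖A n x‖ ≤ C * ‖x‖)
    (hlim : ∀ x, Tendsto (fun n => A n x) atTop (𝓝 x)) : Tendsto A atTop (𝓝 (Lc.id E)) := by
  refine Lc.tendsto_id_of_pointwise (norm_withSeminorms ℂ E) (fun q hq => ?_) hlim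
  obtain ⟨B, hB, hqB⟩ := q.bound_of_continuous_normedSpace hq
  have hC : 0 ≤ |C| := abs_nonneg C
  refine ⟨(B * |C|).toNNReal • normSeminorm ℂ E, ?_, fun n x => ?_⟩
  · change Continuous fun x : E => ((B * |C|).toNNReal : ℝ) * ‖x‖
    fun_prop
  · calc q (A n x) ≤ B * ‖A n x‖ := hqB _
      _ ≤ B * (|C| * ‖x‖) := by
        gcongr
        exact (hA n x).trans (by gcongr; exact le_abs_self C)
      _ = ((B * |C|).toNNReal : ℝ) * ‖x‖ := by
        rw [Real.coe_toNNReal _ (by positivity)]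
        ring

/-! ### Schauder bases -/

/-- The partial sum operators of a Schauder basis of a Banach space are continuous and of finite
rank, and converge to the identity in `L_c(E, E)`. -/
theorem HasSchauderBasis.exists_finiteRank_tendsto {E : Type*} [NormedAddCommGroup E]
    [NormedSpace ℂ E] [CompleteSpace E] (h : HasSchauderBasis E) :
    ∃ P : ℕ → Lc E, (∀ n, P n ∈ finiteRank E) ∧ Tendsto P atTop (𝓝 (Lc.id E)) := by
  obtain ⟨b, hb⟩ := h
  choose t ht huniq using hb
  have huniq' : ∀ e s, Tendsto (fun n => ∑ j ∈ Finset.range n, s j • b j) atTop (𝓝 e) →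
      s = t e := fun e s hs => huniq e s hs
  have tadd : ∀ x y, t (x + y) = t x + t y := fun x y => by
    refine (huniq' _ _ ?_).symm
    simpa [add_smul, Finset.sum_add_distrib] using (ht x).add (ht y)
  have tsmul : ∀ (c : ℂ) x, t (c • x) = c • t x := fun c x => by
    refine (huniq' _ _ ?_).symm
    simpa [mul_smul, Finset.smul_sum] using (ht x).const_smul c
  have hbdd : ∀ e, ∃ C, ∀ n, ‖∑ j ∈ Finset.range n, t e j • b j‖ ≤ C := fun e => by
    obtain ⟨C, hC⟩ := (Metric.isBounded_range_of_tendsto _ (ht e)).exists_norm_le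
    exact ⟨C, fun n => hC _ ⟨n, rfl⟩⟩
  choose C hC using hbdd
  -- All partial sums of `e` are collected in one bounded sequence, so that continuity of `g` is
  -- continuity of the partial sum operators with a common bound. It is proved with the closed graph
  -- theorem.
  let g : E →ₗ[ℂ] BoundedContinuousFunction ℕ E :=
    { toFun := fun e => BoundedContinuousFunction.ofNormedAddCommGroupDiscrete
        (fun n => ∑ j ∈ Finset.range n, t e j • b j) (C e) (hC e)
      map_add' := fun x y => by
        ext n
        simp [tadd, add_smul, Finset.sum_add_distrib]
      map_smul' := fun c x => by
        ext n
        simp [tsmul, mul_smul, Finset.smul_sum] }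
  have hg : ∀ e n, g e n = ∑ j ∈ Finset.range n, t e j • b j := fun _ _ => rfl
  have hcont : Continuous g := by
    refine g.continuous_of_seq_closed_graph fun u x y hu hy => ?_
    have hpt : ∀ n, Tendsto (fun k => g (u k) n) atTop (𝓝 (y n)) := fun n =>
      ((BoundedContinuousFunction.evalCLM ℂ n).continuous.tendsto y).comp hy
    -- The line spanned by `b n` is closed, so the increments of the limit `y` stay in it; thus `y`
    -- is again a sequence of partial sums, with coefficients `s`.
    have hstep : ∀ n, ∃ s : ℂ, y (n + 1) - y n = s • b n := fun n => by
      have hcl : IsClosed ((Submodule.span ℂ {b n} : Submodule ℂ E) : Set E) :=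
        Submodule.closed_of_finiteDimensional _
      have hm : y (n + 1) - y n ∈ (Submodule.span ℂ {b n} : Submodule ℂ E) :=
        hcl.mem_of_tendsto ((hpt (n + 1)).sub (hpt n)) <| Eventually.of_forall fun k => by
          rw [hg, hg, Finset.sum_range_succ, add_sub_cancel_left]
          exact Submodule.smul_mem _ _ (Submodule.mem_span_singleton_self _)
      obtain ⟨s, hs⟩ := Submodule.mem_span_singleton.1 hm
      exact ⟨s, hs.symm⟩
    choose s hs using hstep
    have hsum : ∀ n, y n = ∑ j ∈ Finset.range n, s j • b j := fun n => by
      induction n with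
      | zero => exact tendsto_nhds_unique (hpt 0) (by simp [hg])
      | succ n ih => rw [Finset.sum_range_succ, ← ih, ← hs, add_sub_cancel]
    -- Convergence `g (u k) → y` is uniform in `n`, which permits the exchange of the limits in `n`
    -- and `k`. Uniqueness of expansions then identifies `s` with `t x`.
    have hylim : Tendsto (fun n => y n) atTop (𝓝 x) := by
      rw [Metric.tendsto_atTop]
      intro ε hε
      have h3 : 0 < ε / 3 := by positivity
      obtain ⟨k, hk1, hk2⟩ := ((Metric.tendsto_nhds.1 hu _ h3).and
        (Metric.tendsto_nhds.1 hy _ h3)).exists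
      obtain ⟨N, hN⟩ := Metric.tendsto_atTop.1 (ht (u k)) _ h3
      refine ⟨N, fun n hn => ?_⟩
      have h4 : dist (g (u k) n) (y n) ≤ dist (g (u k)) y :=
        BoundedContinuousFunction.dist_coe_le_dist n
      have h5 : dist (g (u k) n) (u k) < ε / 3 := hN n hn
      calc dist (y n) x ≤ dist (y n) (g (u k) n) + dist (g (u k) n) (u k) + dist (u k) x :=
            dist_triangle4 _ _ _ _
        _ < ε := by
          rw [dist_comm (y n)]
          have : dist (g (u k)) y < ε / 3 := hk2
          linarith
    have hst : s = t x := huniq' x s (by simpa only [← hsum] using hylim)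
    ext n
    rw [hsum, hg, hst]
  let G : E →L[ℂ] BoundedContinuousFunction ℕ E := ⟨g, hcont⟩
  let P : ℕ → E →L[ℂ] E := fun n => (BoundedContinuousFunction.evalCLM ℂ n).comp G
  have hP : ∀ n e, P n e = ∑ j ∈ Finset.range n, t e j • b j := fun _ _ => rfl
  have hb0 : ∀ n, b n ≠ 0 := fun n hn => by
    have h0 : t 0 = 0 := by simpa using tsmul 0 0
    have h1 : Pi.single n (1 : ℂ) = t 0 := huniq' 0 _ <| by
      have : ∀ j, (Pi.single n (1 : ℂ) : ℕ → ℂ) j • b j = 0 := fun j => by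
        rcases eq_or_ne j n with rfl | hj
        · simp [hn]
        · simp [hj]
      simp [this]
    have := congrFun (h1.trans h0) n
    simp at this
  refine ⟨P, fun n => ?_, ?_⟩
  -- The coefficient functional is read off from `P (n + 1) - P n : e ↦ t e n • b n` with a
  -- functional whose value at `b n` is `‖b n‖`.
  · have hrank : ∀ n, ∃ f : E →L[ℂ] ℂ, ∀ e, f e = t e n := fun n => by
      obtain ⟨f, -, hf⟩ := exists_dual_vector ℂ (b n) (norm_ne_zero_iff.2 (hb0 n))
      refine ⟨((‖b n‖ : ℂ)⁻¹) • f.comp (P (n + 1) - P n), fun e => ?_⟩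
      have hne : (‖b n‖ : ℂ) ≠ 0 := by simpa using hb0 n
      have e1 : (P (n + 1) - P n) e = t e n • b n := by
        rw [sub_apply, hP, hP, Finset.sum_range_succ, add_sub_cancel_left]
      simp only [smul_apply, ContinuousLinearMap.comp_apply, e1, map_smul,
        hf, smul_eq_mul]
      change _ * (_ * (‖b n‖ : ℂ)) = _
      field_simp
    choose f hf using hrank
    have : P n = ∑ j ∈ Finset.range n, (Lc.rankOne (f j) (b j) : Lc E) := by
      apply UniformConvergenceCLM.ext
      intro e
      rw [sum_apply]
      refine (hP n e).trans (Finset.sum_congr rfl fun j _ => ?_)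
      rw [← hf]
      rfl
    rw [this]
    exact Submodule.sum_mem _ fun j _ => Submodule.subset_span ⟨(f j, b j), rfl⟩
  · refine Lc.tendsto_id_of_norm_le (C := ‖G‖) (fun n x => ?_) ht
    exact (BoundedContinuousFunction.norm_coe_le_norm (G x) n).trans (G.le_opNorm x)

end Ultra

namespace Ultra

/-! ### Continuity for Beurling and Roumieu limits -/

namespace NormScale

variable {W : Type*} [AddCommGroup W] [Module ℂ W] (N : NormScale W) {r : Regime}

theorem continuous_of_mem_contSeminorms {q : Seminorm ℂ (N.Limit r)} (hq : q ∈ N.contSeminorms r) :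
    Continuous q :=
  (N.withSeminorms r).continuous_seminorm ⟨q, hq⟩

theorem mem_contSeminorms_of_le {p q : Seminorm ℂ (N.Limit r)} (hp : p ∈ N.contSeminorms r)
    (C : ℝ≥0) (h : q ≤ C • p) : q ∈ N.contSeminorms r := by
  have key : ∀ x, ENNReal.ofReal (q x) ≤ C * ENNReal.ofReal (p x) := fun x => by
    rw [← ENNReal.ofReal_coe_nnreal, ← ENNReal.ofReal_mul (p := (C : ℝ)) C.2]
    exact ENNReal.ofReal_le_ofReal (h x)
  cases r with
  | beurling =>
    obtain ⟨k, hk, B, hB⟩ := hp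
    refine ⟨k, hk, C * B, fun x => (key x).trans ?_⟩
    rw [ENNReal.coe_mul, mul_assoc]
    gcongr
    exact hB x
  | roumieu =>
    intro k hk
    obtain ⟨B, hB⟩ := hp k hk
    refine ⟨C * B, fun x hx => (key x).trans ?_⟩
    rw [ENNReal.coe_mul, mul_assoc]
    gcongr
    exact hB x hx

theorem zero_mem_contSeminorms : (0 : Seminorm ℂ (N.Limit r)) ∈ N.contSeminorms r := by
  cases r
  · exact ⟨1, one_pos, 0, fun x => by simp⟩
  · exact fun h _ => ⟨0, fun x _ => by simp⟩

theorem sup_mem_contSeminorms {p q : Seminorm ℂ (N.Limit r)} (hp : p ∈ N.contSeminorms r)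
    (hq : q ∈ N.contSeminorms r) : p ⊔ q ∈ N.contSeminorms r := by
  cases r with
  | beurling =>
    obtain ⟨k, hk, B, hB⟩ := hp
    obtain ⟨l, hl, C, hC⟩ := hq
    refine ⟨max k l, lt_max_of_lt_left hk, max B C, fun x => ?_⟩
    rw [Seminorm.sup_apply]
    rcases max_cases (p x) (q x) with ⟨h, -⟩ | ⟨h, -⟩
    · rw [h]
      refine (hB x).trans ?_
      gcongr
      · exact le_max_left _ _
      · exact N.norm_mono _ _ hk (le_max_left _ _) _
    · rw [h]
      refine (hC x).trans ?_
      gcongr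
      · exact le_max_right _ _
      · exact N.norm_mono _ _ hl (le_max_right _ _) _
  | roumieu =>
    intro k hk
    obtain ⟨B, hB⟩ := hp k hk
    obtain ⟨C, hC⟩ := hq k hk
    refine ⟨max B C, fun x hx => ?_⟩
    rw [Seminorm.sup_apply]
    rcases max_cases (p x) (q x) with ⟨h, -⟩ | ⟨h, -⟩
    · rw [h]
      refine (hB x hx).trans ?_
      gcongr
      exact le_max_left _ _
    · rw [h]
      refine (hC x hx).trans ?_
      gcongr
      exact le_max_right _ _

/-- The family is stable under finite suprema and under domination, so the seminorms that generate
the topology are already all the continuous ones. Continuity can therefore be tested on the steps.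
-/
theorem mem_contSeminorms_iff_continuous {q : Seminorm ℂ (N.Limit r)} :
    q ∈ N.contSeminorms r ↔ Continuous q := by
  classical
  refine ⟨N.continuous_of_mem_contSeminorms, fun hq => ?_⟩
  obtain ⟨s, C, -, hC⟩ := Seminorm.bound_of_continuous (N.withSeminorms r) q hq
  refine N.mem_contSeminorms_of_le ?_ C hC
  refine Finset.sup_induction N.zero_mem_contSeminorms (fun _ hp _ hq =>
    N.sup_mem_contSeminorms hp hq) fun i _ => i.2

/-- A property that has to hold for all `h > 0` in the Beurling case, and for some `h > 0` in the
Roumieu case. -/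
def ForLarge (r : Regime) (P : ℝ → Prop) : Prop :=
  match r with
  | .beurling => ∀ h, 0 < h → P h
  | .roumieu => ∃ h, 0 < h ∧ P h

theorem forLarge_norm_lt_top (x : N.Limit r) : ForLarge r fun h => N.norm h x.val < ⊤ := by
  cases r <;> exact x.2

theorem mem_carrier_of_forLarge {x : W} (hx : ForLarge r fun h => N.norm h x < ⊤) :
    x ∈ N.carrier r := by
  cases r <;> exact hx

theorem ForLarge.mono {P Q : ℝ → Prop} (hP : ForLarge r P) (h : ∀ k, 0 < k → P k → Q k) :
    ForLarge r Q := by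
  cases r with
  | beurling => exact fun k hk => h k hk (hP k hk)
  | roumieu =>
    obtain ⟨k, hk, hPk⟩ := hP
    exact ⟨k, hk, h k hk hPk⟩

/-- Both quantifiers are invariant under dilations of the parameter. This absorbs every loss of a
factor in `h` in the estimates below. -/
theorem ForLarge.rescale {P : ℝ → Prop} (hP : ForLarge r P) {c : ℝ} (hc : 0 < c) :
    ForLarge r fun k => P (c * k) := by
  cases r with
  | beurling => exact fun k hk => hP _ (by positivity)
  | roumieu =>
    obtain ⟨k, hk, hPk⟩ := hP
    refine ⟨k / c, by positivity, ?_⟩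
    change P (c * (k / c))
    rwa [mul_div_cancel₀ _ hc.ne']

theorem ForLarge.exists {P : ℝ → Prop} (hP : ForLarge r P) : ∃ k, 0 < k ∧ P k := by
  cases r with
  | beurling => exact ⟨1, one_pos, hP 1 one_pos⟩
  | roumieu => exact hP

/-- A continuous seminorm on the limit is bounded by some norm of the scale, among those of a family
of norms cofinal in the sense of `ForLarge`. -/
theorem exists_bound_of_forLarge {q : Seminorm ℂ (N.Limit r)} (hq : q ∈ N.contSeminorms r)
    {P : ℝ → Prop} (hP : ForLarge r P) : ∃ h, 0 < h ∧ P h ∧ ∃ C : ℝ≥0, ∀ x : N.Limit r,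
      N.norm h x.val < ⊤ → ENNReal.ofReal (q x) ≤ C * N.norm h x.val := by
  cases r with
  | beurling =>
    obtain ⟨h, hh, C, hC⟩ := hq
    exact ⟨h, hh, hP h hh, C, fun x _ => hC x⟩
  | roumieu =>
    obtain ⟨h, hh, hPh⟩ := hP
    obtain ⟨C, hC⟩ := hq h hh
    exact ⟨h, hh, hPh, C, hC⟩

/-- In the Roumieu case a continuous seminorm is controlled only where the norm is finite;
convergence to `0` in that norm makes it finite eventually. -/
theorem tendsto_of_forLarge {ι : Type*} {l : Filter ι} {u : ι → N.Limit r} {x : N.Limit r}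
    (h : ForLarge r fun h => Tendsto (fun n => N.norm h (u n - x).val) l (𝓝 0)) :
    Tendsto u l (𝓝 x) := by
  rw [(N.withSeminorms r).tendsto_nhds]
  rintro ⟨q, hq⟩ ε hε
  obtain ⟨k, hk, hlim, C, hC⟩ := N.exists_bound_of_forLarge hq h
  have h1 : Tendsto (fun n => (C : ℝ≥0∞) * N.norm k (u n - x).val) l (𝓝 0) := by
    simpa using ENNReal.Tendsto.const_mul hlim (Or.inr ENNReal.coe_ne_top)
  filter_upwards [h1.eventually_lt_const (ENNReal.ofReal_pos.2 hε),
    hlim.eventually_lt_const ENNReal.zero_lt_top] with n hn hn'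
  exact (ENNReal.ofReal_lt_ofReal_iff hε).1 ((hC _ hn').trans_lt hn)

theorem continuous_of_forLarge {E : Type*} [NormedAddCommGroup E] [NormedSpace ℂ E]
    (f : E →ₗ[ℂ] N.Limit r)
    (h : ForLarge r fun h => ∃ C : ℝ≥0, ∀ e, N.norm h (f e).val ≤ C * ‖e‖ₑ) : Continuous f := by
  refine WithSeminorms.continuous_of_continuous_comp (N.withSeminorms r) f ?_
  rintro ⟨q, hq⟩
  obtain ⟨k, hk, ⟨B, hB⟩, C, hC⟩ := N.exists_bound_of_forLarge hq h
  have hcont : Continuous ((C * B) • normSeminorm ℂ E) := by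
    change Continuous fun x : E => ((C * B : ℝ≥0) : ℝ) * ‖x‖
    fun_prop
  refine Seminorm.continuous_of_le hcont fun e => ?_
  change q (f e) ≤ ((C * B : ℝ≥0) : ℝ) * ‖e‖
  have hfin : N.norm k (f e).val < ⊤ :=
    (hB e).trans_lt (ENNReal.mul_lt_top ENNReal.coe_lt_top enorm_lt_top)
  have h1 : ENNReal.ofReal (q (f e)) ≤ ENNReal.ofReal (((C * B : ℝ≥0) : ℝ) * ‖e‖) := by
    refine (hC _ hfin).trans ?_
    rw [ENNReal.ofReal_mul (by positivity), ENNReal.ofReal_coe_nnreal, ofReal_norm,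
      ENNReal.coe_mul, mul_assoc]
    gcongr
    exact hB e
  exact (ENNReal.ofReal_le_ofReal_iff (by positivity)).1 h1

theorem continuous_of_comp_mem {E : Type*} [NormedAddCommGroup E] [NormedSpace ℂ E]
    (f : N.Limit r →ₗ[ℂ] E) (h : (normSeminorm ℂ E).comp f ∈ N.contSeminorms r) :
    Continuous f :=
  WithSeminorms.continuous_of_continuous_comp (norm_withSeminorms ℂ E) f fun _ =>
    N.continuous_of_mem_contSeminorms h

/-- Operators on the limit which are bounded on every step, uniformly, are equicontinuous. -/
theorem exists_continuous_seminorm_bound {A : ℕ → N.Limit r →ₗ[ℂ] N.Limit r} {C : ℝ≥0}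
    (hA : ∀ h, 0 < h → ∀ n x, N.norm h (A n x).val ≤ C * N.norm h x.val)
    {q : Seminorm ℂ (N.Limit r)} (hq : Continuous q) :
    ∃ p : Seminorm ℂ (N.Limit r), Continuous p ∧ ∀ n x, q (A n x) ≤ p x := by
  rw [← N.mem_contSeminorms_iff_continuous] at hq
  have step : ∀ h, 0 < h → ∀ B : ℝ≥0, (∀ x : N.Limit r, N.norm h x.val < ⊤ →
      ENNReal.ofReal (q x) ≤ B * N.norm h x.val) → ∀ x : N.Limit r, N.norm h x.val < ⊤ →
      ∀ n, q (A n x) ≤ ((B * C : ℝ≥0) * N.norm h x.val).toReal := by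
    intro h hh B hB x hx n
    have h1 : N.norm h (A n x).val < ⊤ :=
      (hA h hh n x).trans_lt (ENNReal.mul_lt_top ENNReal.coe_lt_top hx)
    refine (ENNReal.ofReal_le_iff_le_toReal
      (ENNReal.mul_lt_top ENNReal.coe_lt_top hx).ne).1 ((hB _ h1).trans ?_)
    rw [ENNReal.coe_mul, mul_assoc]
    gcongr
    exact hA h hh n x
  -- The dominating seminorm is the supremum of the `q.comp (A n)`. It is finite at each point
  -- because the point lies in a step, and it is bounded on the steps because `C` does not depend on
  -- `n`.
  have hbdd : BddAbove (Set.range fun n => q.comp (A n)) := by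
    rw [Seminorm.bddAbove_range_iff]
    intro x
    obtain ⟨h, hh, hx, B, hB⟩ := N.exists_bound_of_forLarge hq (N.forLarge_norm_lt_top x)
    refine ⟨((B * C : ℝ≥0) * N.norm h x.val).toReal, ?_⟩
    rintro _ ⟨n, rfl⟩
    exact step h hh B hB x hx n
  have hsup : ∀ x, (⨆ n, q.comp (A n)) x = ⨆ n, q (A n x) := fun x => by
    rw [Seminorm.coe_iSup_eq hbdd, iSup_apply]
    rfl
  have hfinal : ∀ h, 0 < h → ∀ B : ℝ≥0, (∀ x : N.Limit r, N.norm h x.val < ⊤ →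
      ENNReal.ofReal (q x) ≤ B * N.norm h x.val) → ∀ x : N.Limit r, N.norm h x.val < ⊤ →
      ENNReal.ofReal ((⨆ n, q.comp (A n)) x) ≤ (B * C : ℝ≥0) * N.norm h x.val := by
    intro h hh B hB x hx
    rw [hsup, ENNReal.ofReal_le_iff_le_toReal (ENNReal.mul_lt_top ENNReal.coe_lt_top hx).ne]
    exact ciSup_le (step h hh B hB x hx)
  refine ⟨⨆ n, q.comp (A n), N.mem_contSeminorms_iff_continuous.1 ?_, fun n x => ?_⟩
  · cases r with
    | beurling =>
      obtain ⟨h, hh, B, hB⟩ := hq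
      exact ⟨h, hh, B * C, fun x => hfinal h hh B (fun x _ => hB x) x (x.2 h hh)⟩
    | roumieu =>
      intro h hh
      obtain ⟨B, hB⟩ := hq h hh
      exact ⟨B * C, hfinal h hh B hB⟩
  · rw [hsup]
    exact le_ciSup ((Seminorm.bddAbove_range_iff.1 hbdd) x) n

end NormScale

end Ultra

namespace Ultra

/-! ### Weight sequences and the associated function -/

namespace WeightPair

variable (w : WeightPair)

theorem bddAbove_assoc {ρ : ℝ} (hρ : 0 ≤ ρ) :
    BddAbove (Set.range fun p : ℕ => Real.posLog (ρ ^ p / w.A p)) := by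
  obtain ⟨c, L, hc, hL, hA⟩ := w.factorial_le_A
  refine ⟨Real.posLog (c * Real.exp (L * ρ)), ?_⟩
  rintro _ ⟨p, rfl⟩
  have hp := w.A_pos p
  apply Real.posLog_le_posLog
  · positivity
  · have hf : (0 : ℝ) < Nat.factorial p := by positivity
    have h1 := Real.pow_div_factorial_le_exp (x := L * ρ) (by positivity) p
    rw [div_le_iff₀ hp]
    rw [div_le_iff₀ hf, mul_pow] at h1
    have h2 : L ^ p * ρ ^ p ≤ Real.exp (L * ρ) * (c * L ^ p * w.A p) :=
      h1.trans (mul_le_mul_of_nonneg_left (hA p) (Real.exp_pos _).le)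
    have hLp : 0 < L ^ p := by positivity
    refine le_of_mul_le_mul_left ?_ hLp
    nlinarith [h2]

theorem assoc_nonneg (ρ : ℝ) : 0 ≤ w.assoc ρ :=
  Real.iSup_nonneg fun _ => Real.posLog_nonneg

theorem one_le_exp_assoc (ρ : ℝ) : 1 ≤ Real.exp (w.assoc ρ) :=
  Real.one_le_exp (w.assoc_nonneg ρ)

theorem pow_div_le_exp_assoc {ρ : ℝ} (hρ : 0 ≤ ρ) (p : ℕ) :
    ρ ^ p / w.A p ≤ Real.exp (w.assoc ρ) := by
  refine (Real.le_exp_log _).trans (Real.exp_le_exp.2 ?_)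
  exact (le_max_right _ _).trans (le_ciSup (w.bddAbove_assoc hρ) p)

/-- The condition `1 ≤ B` accounts for the positive part in `log⁺`. -/
theorem exp_assoc_le {ρ B : ℝ} (hρ : 0 ≤ ρ) (hB : 1 ≤ B) (h : ∀ p, ρ ^ p / w.A p ≤ B) :
    Real.exp (w.assoc ρ) ≤ B := by
  rw [← Real.le_log_iff_exp_le (by positivity),
    ← Real.posLog_eq_log (by rwa [abs_of_nonneg (by positivity)])]
  refine ciSup_le fun p => Real.posLog_le_posLog ?_ (h p)
  have := w.A_pos p
  positivity

theorem exp_assoc_add_le {a b : ℝ} (ha : 0 ≤ a) (hb : 0 ≤ b) :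
    Real.exp (w.assoc (a + b)) ≤ Real.exp (w.assoc (2 * a)) * Real.exp (w.assoc (2 * b)) := by
  rw [← Real.exp_add, Real.exp_le_exp]
  have h1 := w.assoc_nonneg (2 * a)
  have h2 := w.assoc_nonneg (2 * b)
  rcases le_total a b with h | h
  · have := w.assoc_mono (by positivity) (show a + b ≤ 2 * b by linarith)
    linarith
  · have := w.assoc_mono (by positivity) (show a + b ≤ 2 * a by linarith)
    linarith

/-- By (M.2) for `A` at `(2p, p)`, the square of `ρ ^ p / A p` is at most `c` times the term of
index `2p` in the supremum at `H * ρ`. -/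
theorem exists_exp_assoc_sq_le : ∃ c H : ℝ, 1 ≤ c ∧ 1 ≤ H ∧ ∀ ρ, 0 ≤ ρ →
    Real.exp (w.assoc ρ) ^ 2 ≤ c * Real.exp (w.assoc (H * ρ)) := by
  obtain ⟨c, H, hc, hH, hA⟩ := w.A_stable
  refine ⟨c, H, hc, hH, fun ρ hρ => ?_⟩
  have hE := w.one_le_exp_assoc (H * ρ)
  have hcE : 1 ≤ c * Real.exp (w.assoc (H * ρ)) := one_le_mul_of_one_le_of_one_le hc hE
  have key : Real.exp (w.assoc ρ) ≤ √(c * Real.exp (w.assoc (H * ρ))) := by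
    refine w.exp_assoc_le hρ (Real.one_le_sqrt.2 hcE) fun p => ?_
    have hp := w.A_pos p
    have h2p := w.A_pos (2 * p)
    refine Real.le_sqrt_of_sq_le ?_
    have h1 := hA (2 * p) p (by omega)
    rw [show 2 * p - p = p by omega] at h1
    have h2 := w.pow_div_le_exp_assoc (ρ := H * ρ) (by positivity) (2 * p)
    calc (ρ ^ p / w.A p) ^ 2 = ρ ^ (2 * p) / (w.A p * w.A p) := by
          rw [div_pow, ← pow_mul, mul_comm p 2, sq (w.A p)]
      _ ≤ c * ((H * ρ) ^ (2 * p) / w.A (2 * p)) := by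
          rw [← mul_div_assoc, div_le_div_iff₀ (by positivity) h2p, mul_pow]
          have : 0 ≤ ρ ^ (2 * p) := by positivity
          calc ρ ^ (2 * p) * w.A (2 * p)
              ≤ ρ ^ (2 * p) * (c * H ^ (2 * p) * (w.A p * w.A p)) := by gcongr
            _ = c * (H ^ (2 * p) * ρ ^ (2 * p)) * (w.A p * w.A p) := by ring
      _ ≤ c * Real.exp (w.assoc (H * ρ)) := by gcongr
  calc Real.exp (w.assoc ρ) ^ 2 ≤ √(c * Real.exp (w.assoc (H * ρ))) ^ 2 := by gcongr
    _ = _ := Real.sq_sqrt (by positivity)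

theorem exists_one_add_pow_le (n : ℕ) {τ : ℝ} (hτ : 0 < τ) : ∃ C : ℝ, 0 < C ∧ ∀ ρ, 0 ≤ ρ →
    (1 + ρ) ^ n ≤ C * Real.exp (w.assoc (τ * ρ)) := by
  have hA := w.A_pos n
  refine ⟨2 ^ n * (1 + w.A n / τ ^ n), by positivity, fun ρ hρ => ?_⟩
  have hE := w.one_le_exp_assoc (τ * ρ)
  have h1 := w.pow_div_le_exp_assoc (ρ := τ * ρ) (by positivity) n
  have h2 : ρ ^ n ≤ w.A n / τ ^ n * Real.exp (w.assoc (τ * ρ)) := by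
    rw [div_le_iff₀ hA, mul_pow] at h1
    rw [div_mul_eq_mul_div, le_div_iff₀ (by positivity)]
    linarith
  have h3 : (1 + ρ) ^ n ≤ 2 ^ n * (1 + ρ ^ n) := by
    rcases le_total ρ 1 with h | h
    · calc (1 + ρ) ^ n ≤ 2 ^ n := by gcongr; linarith
        _ ≤ 2 ^ n * (1 + ρ ^ n) := le_mul_of_one_le_right (by positivity)
          (by have : 0 ≤ ρ ^ n := by positivity
              linarith)
    · calc (1 + ρ) ^ n ≤ (2 * ρ) ^ n := by gcongr; linarith
        _ = 2 ^ n * ρ ^ n := mul_pow _ _ _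
        _ ≤ 2 ^ n * (1 + ρ ^ n) := by gcongr; linarith
  calc (1 + ρ) ^ n ≤ 2 ^ n * (1 + ρ ^ n) := h3
    _ ≤ 2 ^ n * (Real.exp (w.assoc (τ * ρ)) + w.A n / τ ^ n * Real.exp (w.assoc (τ * ρ))) := by
      gcongr
    _ = _ := by ring

/-- For `k` large with respect to `τ`, the weight `e^{A(kρ)}` dominates `e^{A(τρ)}` times any power
of `ρ`. -/
theorem exists_exp_assoc_mul_pow_le (n : ℕ) : ∃ H : ℝ, 1 ≤ H ∧ ∀ τ, 0 < τ → ∃ C : ℝ, 0 < C ∧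
    ∀ k, H * τ ≤ k → ∀ ρ, 0 ≤ ρ →
      Real.exp (w.assoc (τ * ρ)) * (1 + ρ) ^ n ≤ C * Real.exp (w.assoc (k * ρ)) := by
  obtain ⟨c, H, hc, hH, hsq⟩ := w.exists_exp_assoc_sq_le
  refine ⟨H, hH, fun τ hτ => ?_⟩
  obtain ⟨C, hC, hpow⟩ := w.exists_one_add_pow_le n hτ
  refine ⟨C * c, by positivity, fun k hk ρ hρ => ?_⟩
  have hmono : w.assoc (H * (τ * ρ)) ≤ w.assoc (k * ρ) :=
    w.assoc_mono (by positivity) (by rw [← mul_assoc]; gcongr)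
  calc Real.exp (w.assoc (τ * ρ)) * (1 + ρ) ^ n
      ≤ Real.exp (w.assoc (τ * ρ)) * (C * Real.exp (w.assoc (τ * ρ))) := by
        gcongr
        exact hpow ρ hρ
    _ = C * Real.exp (w.assoc (τ * ρ)) ^ 2 := by ring
    _ ≤ C * (c * Real.exp (w.assoc (H * (τ * ρ)))) := by
        gcongr
        exact hsq _ (by positivity)
    _ ≤ C * (c * Real.exp (w.assoc (k * ρ))) := by gcongr
    _ = _ := by ring

theorem exists_M_succ_le : ∃ c H : ℝ, 1 ≤ c ∧ 1 ≤ H ∧ ∀ p, w.M (p + 1) ≤ c * H ^ p * w.M p := by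
  obtain ⟨c, H, hc, hH, hM⟩ := w.M_stable
  refine ⟨c * H, H, one_le_mul_of_one_le_of_one_le hc hH, hH, fun p => ?_⟩
  have := hM (p + 1) 1 (by omega)
  rw [Nat.add_sub_cancel, w.M_one, mul_one, pow_succ] at this
  linarith

/-- Log-convexity means that the quotients `M (p + 1) / M p` increase; this is that monotonicity
with denominators cleared. With `M 0 = 1` it yields `M_mul_le`. -/
theorem M_succ_mul_le (a b : ℕ) : w.M (a + 1) * w.M (a + b) ≤ w.M a * w.M (a + b + 1) := by
  induction b with
  | zero => simp [mul_comm]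
  | succ b ih =>
    have e := w.M_logConvex (a + b + 1) (by omega)
    rw [Nat.add_sub_cancel] at e
    have p0 := w.M_pos a
    have p2 := w.M_pos (a + b)
    have p3 := w.M_pos (a + b + 1)
    rw [← add_assoc]
    refine le_of_mul_le_mul_right ?_ p2
    calc w.M (a + 1) * w.M (a + b + 1) * w.M (a + b)
        = w.M (a + 1) * w.M (a + b) * w.M (a + b + 1) := by ring
      _ ≤ w.M a * w.M (a + b + 1) * w.M (a + b + 1) := by gcongr
      _ = w.M a * w.M (a + b + 1) ^ 2 := by ring
      _ ≤ w.M a * (w.M (a + b) * w.M (a + b + 1 + 1)) := by gcongr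
      _ = w.M a * w.M (a + b + 1 + 1) * w.M (a + b) := by ring

theorem M_mul_le (p q : ℕ) : w.M p * w.M q ≤ w.M (p + q) := by
  induction p with
  | zero => simp [w.M_zero]
  | succ p ih =>
    have h0 := w.M_pos p
    have h1 := w.M_pos (p + 1)
    rw [show p + 1 + q = p + q + 1 by ring]
    refine le_of_mul_le_mul_left ?_ h0
    calc w.M p * (w.M (p + 1) * w.M q) = w.M (p + 1) * (w.M p * w.M q) := by ring
      _ ≤ w.M (p + 1) * w.M (p + q) := by gcongr
      _ ≤ w.M p * w.M (p + q + 1) := w.M_succ_mul_le p q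

end WeightPair

end Ultra

namespace Ultra

variable {d : ℕ}

/-! ### Calculus of the partial derivatives `∂^α` -/

theorem differentiable_of_smooth {f : Rd d → ℂ} (hf : ContDiff ℝ ∞ f) : Differentiable ℝ f :=
  hf.differentiable (by simp)

theorem pd_comm (i j : Fin d) {f : Rd d → ℂ} (hf : ContDiff ℝ ∞ f) :
    pd i (pd j f) = pd j (pd i f) := by
  have h2 : ContDiff ℝ ∞ (fderiv ℝ f) := hf.fderiv_right (by simp)
  have hd : Differentiable ℝ (fderiv ℝ f) := h2.differentiable (by simp)
  have key : ∀ (i j : Fin d) x, pd i (pd j f) x = fderiv ℝ (fderiv ℝ f) x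
      (EuclideanSpace.single i 1) (EuclideanSpace.single j 1) := by
    intro i j x
    have := ((hd x).hasFDerivAt.clm_apply
      (hasFDerivAt_const (EuclideanSpace.single j (1 : ℝ)) x)).fderiv
    change fderiv ℝ (fun x => fderiv ℝ f x (EuclideanSpace.single j 1)) x _ = _
    rw [this]
    simp
  funext x
  rw [key, key]
  exact (hf.contDiffAt.isSymmSndFDerivAt
    (by simpa using WithTop.coe_le_coe.2 (le_top : (2 : ℕ∞) ≤ ⊤))).eq _ _

theorem pd_iter_smooth (i : Fin d) (n : ℕ) {f : Rd d → ℂ} (hf : ContDiff ℝ ∞ f) :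
    ContDiff ℝ ∞ ((pd i)^[n] f) :=
  (pd_iter i n 0 hf hf).1

theorem pd_iter_comm (i j : Fin d) (n : ℕ) {f : Rd d → ℂ} (hf : ContDiff ℝ ∞ f) :
    pd i ((pd j)^[n] f) = (pd j)^[n] (pd i f) := by
  induction n generalizing f with
  | zero => rfl
  | succ n ih =>
    rw [Function.iterate_succ_apply, ih (pd_smooth j hf), pd_comm i j hf,
      ← Function.iterate_succ_apply]

/-- The composition of the operators `∂_i^{α_i}` for `i` in a list. -/
def listDeriv (α : Fin d → ℕ) (l : List (Fin d)) (f : Rd d → ℂ) : Rd d → ℂ :=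
  l.foldr (fun i g => (pd i)^[α i] g) f

theorem listDeriv_smooth (α : Fin d → ℕ) (l : List (Fin d)) {f : Rd d → ℂ}
    (hf : ContDiff ℝ ∞ f) : ContDiff ℝ ∞ (listDeriv α l f) := by
  induction l with
  | nil => exact hf
  | cons i l ih => exact pd_iter_smooth i _ ih

theorem pd_listDeriv (α : Fin d → ℕ) (l : List (Fin d)) (i : Fin d) {f : Rd d → ℂ}
    (hf : ContDiff ℝ ∞ f) : pd i (listDeriv α l f) = listDeriv α l (pd i f) := by
  induction l with
  | nil => rfl
  | cons j l ih =>
    change pd i ((pd j)^[α j] (listDeriv α l f)) = (pd j)^[α j] (listDeriv α l (pd i f))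
    rw [pd_iter_comm i j _ (listDeriv_smooth α l hf), ih]

theorem listDeriv_add_single_of_notMem (α : Fin d → ℕ) {l : List (Fin d)} {i : Fin d}
    (hi : i ∉ l) (f : Rd d → ℂ) : listDeriv (α + Pi.single i 1) l f = listDeriv α l f := by
  induction l with
  | nil => rfl
  | cons j l ih =>
    rw [List.mem_cons, not_or] at hi
    change (pd j)^[(α + Pi.single i 1 : Fin d → ℕ) j] (listDeriv _ l f) = (pd j)^[α j] (listDeriv α l f)
    rw [ih hi.2]
    simp [Pi.single_eq_of_ne (Ne.symm hi.1)]

/-- The operator `∂^α` applies the coordinates in a fixed order, each once; since partial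
derivatives of smooth functions commute, an extra `∂_i` can be moved outside. This is what allows
induction on `α` one derivative at a time. -/
theorem listDeriv_add_single_of_mem (α : Fin d → ℕ) {l : List (Fin d)} (hl : l.Nodup) {i : Fin d}
    (hi : i ∈ l) {f : Rd d → ℂ} (hf : ContDiff ℝ ∞ f) :
    listDeriv (α + Pi.single i 1) l f = pd i (listDeriv α l f) := by
  induction l with
  | nil => simp at hi
  | cons j l ih =>
    rw [List.nodup_cons] at hl
    change (pd j)^[(α + Pi.single i 1 : Fin d → ℕ) j] (listDeriv _ l f) = pd i ((pd j)^[α j] (listDeriv α l f))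
    rcases eq_or_ne i j with rfl | hij
    · rw [listDeriv_add_single_of_notMem α hl.1]
      simp only [Pi.add_apply, Pi.single_eq_same]
      rw [Function.iterate_succ_apply']
    · have hil : i ∈ l := (List.mem_cons.1 hi).resolve_left hij
      rw [ih hl.2 hil, pd_iter_comm i j _ (listDeriv_smooth α l hf)]
      simp [Pi.single_eq_of_ne hij.symm]

theorem mderiv_smooth (α : Fin d → ℕ) {f : Rd d → ℂ} (hf : ContDiff ℝ ∞ f) :
    ContDiff ℝ ∞ (mderiv α f) :=
  listDeriv_smooth α _ hf

theorem mderiv_add_single (α : Fin d → ℕ) (i : Fin d) {f : Rd d → ℂ} (hf : ContDiff ℝ ∞ f) :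
    mderiv (α + Pi.single i 1) f = pd i (mderiv α f) :=
  listDeriv_add_single_of_mem α (List.nodup_finRange d) (List.mem_finRange i) hf

theorem mderiv_add_single' (α : Fin d → ℕ) (i : Fin d) {f : Rd d → ℂ} (hf : ContDiff ℝ ∞ f) :
    mderiv (α + Pi.single i 1) f = mderiv α (pd i f) := by
  rw [mderiv_add_single α i hf]
  exact pd_listDeriv α _ i hf

@[simp]
theorem mderiv_zero (f : Rd d → ℂ) : mderiv 0 f = f := by
  have : ∀ l : List (Fin d), listDeriv 0 l f = f := by
    intro l
    induction l with
    | nil => rfl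
    | cons i l ih => exact ih
  exact this _

@[simp]
theorem order_zero : order (0 : Fin d → ℕ) = 0 := by simp [order]

theorem order_add (α β : Fin d → ℕ) : order (α + β) = order α + order β :=
  Finset.sum_add_distrib

@[simp]
theorem order_single (i : Fin d) : order (Pi.single i 1 : Fin d → ℕ) = 1 := by
  simp [order]

/-- Induction on multi-indices. -/
theorem multiIndex_induction {P : (Fin d → ℕ) → Prop} (zero : P 0)
    (succ : ∀ α i, P α → P (α + Pi.single i 1)) (α : Fin d → ℕ) : P α := by
  induction h : order α generalizing α with
  | zero =>
    have : α = 0 := by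
      funext i
      exact (Finset.sum_eq_zero_iff.1 h) i (Finset.mem_univ i)
    rwa [this]
  | succ n ih =>
    obtain ⟨i, hi⟩ : ∃ i, α i ≠ 0 := by
      by_contra! hc
      simp [order, hc] at h
    have e : α = (α - Pi.single i 1) + Pi.single i 1 := by
      funext j
      rcases eq_or_ne j i with rfl | hj
      · simp
        omega
      · simp [Pi.single_eq_of_ne hj]
    rw [e]
    refine succ _ _ (ih _ ?_)
    rw [e, order_add, order_single] at h
    omega

theorem mderiv_sub (α : Fin d → ℕ) {f g : Rd d → ℂ} (hf : ContDiff ℝ ∞ f) (hg : ContDiff ℝ ∞ g) :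
    mderiv α (f - g) = mderiv α f - mderiv α g := by
  have h1 : ContDiff ℝ ∞ ((-1 : ℂ) • g) := (smoothFun d).smul_mem (-1) hg
  rw [sub_eq_add_neg, ← neg_one_smul ℂ g, (mderiv_linear α 0 hf h1).1,
    (mderiv_linear α (-1) hg hg).2, neg_one_smul, ← sub_eq_add_neg]

theorem contDiff_affine (z : Rd d) (ε : ℝ) {f : Rd d → ℂ} (hf : ContDiff ℝ ∞ f) :
    ContDiff ℝ ∞ fun x => f (z + ε • x) :=
  hf.comp (contDiff_const.add (contDiff_id.const_smul ε))

theorem pd_affine (i : Fin d) (z : Rd d) (ε : ℝ) {f : Rd d → ℂ} (hf : ContDiff ℝ ∞ f) :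
    pd i (fun x => f (z + ε • x)) = fun x => (ε : ℂ) * pd i f (z + ε • x) := by
  funext x
  have h1 : HasFDerivAt (fun x : Rd d => z + ε • x) (ε • ContinuousLinearMap.id ℝ (Rd d)) x :=
    ((hasFDerivAt_id x).const_smul ε).const_add z
  have h2 := ((differentiable_of_smooth hf (z + ε • x)).hasFDerivAt.comp x h1).fderiv
  change fderiv ℝ (f ∘ fun x => z + ε • x) x _ = _
  rw [h2]
  simp [pd]

theorem mderiv_affine (α : Fin d → ℕ) (z : Rd d) (ε : ℝ) {f : Rd d → ℂ} (hf : ContDiff ℝ ∞ f) :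
    mderiv α (fun x => f (z + ε • x)) = fun x => (ε : ℂ) ^ order α * mderiv α f (z + ε • x) := by
  induction α using multiIndex_induction with
  | zero => simp
  | succ α i ih =>
    have hg := contDiff_affine z ε (mderiv_smooth α hf)
    rw [mderiv_add_single α i (contDiff_affine z ε hf), ih, mderiv_add_single α i hf]
    have : (fun x => (ε : ℂ) ^ order α * mderiv α f (z + ε • x)) =
        (ε : ℂ) ^ order α • fun x => mderiv α f (z + ε • x) := rfl
    rw [this, pd_smul i _ hg, pd_affine i z ε (mderiv_smooth α hf)]
    funext x
    simp only [Pi.smul_apply, smul_eq_mul, order_add, order_single]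
    ring

theorem contDiff_translate (y : Rd d) {f : Rd d → ℂ} (hf : ContDiff ℝ ∞ f) :
    ContDiff ℝ ∞ fun x => f (x - y) :=
  hf.comp (contDiff_id.sub contDiff_const)

theorem mderiv_translate (α : Fin d → ℕ) (y : Rd d) {f : Rd d → ℂ} (hf : ContDiff ℝ ∞ f) :
    mderiv α (fun x => f (x - y)) = fun x => mderiv α f (x - y) := by
  have := mderiv_affine α (-y) 1 hf
  simpa [neg_add_eq_sub] using this

theorem contDiff_conj {f : Rd d → ℂ} (hf : ContDiff ℝ ∞ f) :
    ContDiff ℝ ∞ fun x => (starRingEnd ℂ) (f x) :=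
  Complex.conjCLE.contDiff.comp hf

theorem mderiv_conj (α : Fin d → ℕ) {f : Rd d → ℂ} (hf : ContDiff ℝ ∞ f) :
    mderiv α (fun x => (starRingEnd ℂ) (f x)) = fun x => (starRingEnd ℂ) (mderiv α f x) := by
  induction α using multiIndex_induction with
  | zero => simp
  | succ α i ih =>
    rw [mderiv_add_single α i (contDiff_conj hf), ih, mderiv_add_single α i hf]
    funext x
    have h := (Complex.conjCLE.toContinuousLinearMap.hasFDerivAt.comp x
      (differentiable_of_smooth (mderiv_smooth α hf) x).hasFDerivAt).fderiv
    change fderiv ℝ (Complex.conjCLE ∘ mderiv α f) x _ = _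
    rw [pd]
    erw [h]
    rfl

theorem pd_mul (i : Fin d) {f g : Rd d → ℂ} (hf : ContDiff ℝ ∞ f) (hg : ContDiff ℝ ∞ g) :
    pd i (fun x => f x * g x) = (fun x => f x * pd i g x) + fun x => pd i f x * g x := by
  funext x
  have := ((differentiable_of_smooth hf x).hasFDerivAt.mul
    (differentiable_of_smooth hg x).hasFDerivAt).fderiv
  change fderiv ℝ (f * g) x _ = _
  rw [this]
  simp [pd, mul_comm]

/-- A pointwise estimate for the derivatives of a product. -/
theorem norm_mderiv_mul_le (w : WeightPair) {h a b : ℝ} (hh : 0 < h) (ha : 0 ≤ a) (hb : 0 ≤ b)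
    {f g : Rd d → ℂ} (hf : ContDiff ℝ ∞ f) (hg : ContDiff ℝ ∞ g) {x : Rd d}
    (hfx : ∀ α, h ^ order α * ‖mderiv α f x‖ ≤ a * w.M (order α))
    (hgx : ∀ α, h ^ order α * ‖mderiv α g x‖ ≤ b * w.M (order α)) (α : Fin d → ℕ) :
    (h / 2) ^ order α * ‖mderiv α (fun x => f x * g x) x‖ ≤ a * b * w.M (order α) := by
  -- Products of arbitrary derivatives of `f` and `g` are treated at once, so that the Leibniz rule
  -- closes the induction. Each derivative doubles the number of terms, whence `2 ^ order α`, which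
  -- is paid for by `h / 2`; the base case is `M_mul_le`.
  have key : ∀ α β γ : Fin d → ℕ, h ^ (order α + order β + order γ) *
      ‖mderiv α (fun x => mderiv β f x * mderiv γ g x) x‖ ≤
        2 ^ order α * (a * b * w.M (order α + order β + order γ)) := by
    intro α
    induction α using multiIndex_induction with
    | zero =>
      intro β γ
      have h1 := hfx β
      have h2 := hgx γ
      have hM := w.M_mul_le (order β) (order γ)
      simp only [mderiv_zero, order_zero, zero_add, norm_mul, pow_zero, one_mul]
      calc h ^ (order β + order γ) * (‖mderiv β f x‖ * ‖mderiv γ g x‖)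
          = (h ^ order β * ‖mderiv β f x‖) * (h ^ order γ * ‖mderiv γ g x‖) := by ring
        _ ≤ (a * w.M (order β)) * (b * w.M (order γ)) := by
          have := w.M_pos (order β)
          gcongr
        _ = a * b * (w.M (order β) * w.M (order γ)) := by ring
        _ ≤ _ := by gcongr
    | succ α i ih =>
      intro β γ
      have sf := mderiv_smooth β hf
      have sg := mderiv_smooth γ hg
      have s1 := pd_smooth i sf
      have s2 := pd_smooth i sg
      rw [mderiv_add_single' α i (sf.mul sg), pd_mul i sf sg,
        (mderiv_linear α 0 (sf.mul s2) (s1.mul sg)).1, Pi.add_apply]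
      have i1 := ih (β + Pi.single i 1) γ
      have i2 := ih β (γ + Pi.single i 1)
      rw [mderiv_add_single β i hf] at i1
      rw [mderiv_add_single γ i hg] at i2
      simp only [order_add, order_single] at i1 i2 ⊢
      rw [show order α + (order β + 1) + order γ = order α + 1 + order β + order γ by ring] at i1
      rw [show order α + order β + (order γ + 1) = order α + 1 + order β + order γ by ring] at i2
      refine (mul_le_mul_of_nonneg_left (norm_add_le _ _) (by positivity)).trans ?_
      rw [mul_add, pow_succ (2 : ℝ)]
      linarith
  have := key α 0 0
  simp only [mderiv_zero, order_zero, add_zero] at this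
  rw [div_pow, div_mul_eq_mul_div, div_le_iff₀ (by positivity)]
  linarith

/-! ### Integration by parts -/

open MeasureTheory in
theorem integral_pd_mul (i : Fin d) {f g : Rd d → ℂ} (hf : ContDiff ℝ ∞ f) (hg : ContDiff ℝ ∞ g)
    (hfi : Integrable f) (hfi' : Integrable (pd i f)) {C C' : ℝ} (hgb : ∀ x, ‖g x‖ ≤ C)
    (hgb' : ∀ x, ‖pd i g x‖ ≤ C') : ∫ x, pd i f x * g x = -∫ x, f x * pd i g x := by
  have h1 : Integrable (fun x => pd i f x * g x) :=
    hfi'.mul_bdd hg.continuous.aestronglyMeasurable (Eventually.of_forall hgb)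
  have h2 : Integrable (fun x => f x * pd i g x) :=
    hfi.mul_bdd (pd_smooth i hg).continuous.aestronglyMeasurable (Eventually.of_forall hgb')
  have h3 : Integrable (fun x => f x * g x) :=
    hfi.mul_bdd hg.continuous.aestronglyMeasurable (Eventually.of_forall hgb)
  have := integral_mul_fderiv_eq_neg_fderiv_mul_of_integrable (μ := volume) (f := f) (g := g)
    (v := EuclideanSpace.single i 1) h1 h2 h3
    (fun x _ => differentiable_of_smooth hf x) (fun x _ => differentiable_of_smooth hg x)
  change ∫ x, f x * pd i g x = -∫ x, pd i f x * g x at this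
  rw [this, neg_neg]

-- Derivatives are moved to `g` one at a time. Integrability of the derivatives of `f` suffices,
-- with `g` and its derivatives merely bounded.
open MeasureTheory in
theorem integral_mderiv_mul (α : Fin d → ℕ) {f g : Rd d → ℂ} (hf : ContDiff ℝ ∞ f)
    (hg : ContDiff ℝ ∞ g) (hfi : ∀ α, Integrable (mderiv α f))
    (hgb : ∀ α, ∃ C, ∀ x, ‖mderiv α g x‖ ≤ C) :
    ∫ x, mderiv α f x * g x = (-1) ^ order α * ∫ x, f x * mderiv α g x := by
  induction α using multiIndex_induction generalizing g with
  | zero => simp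
  | succ α i ih =>
    obtain ⟨C, hC⟩ := hgb 0
    obtain ⟨C', hC'⟩ := hgb (0 + Pi.single i 1)
    rw [mderiv_add_single 0 i hg, mderiv_zero] at hC'
    have h1 := hfi (α + Pi.single i 1)
    rw [mderiv_add_single α i hf] at h1 ⊢
    rw [integral_pd_mul i (mderiv_smooth α hf) hg (hfi α) h1 (by simpa using hC) hC',
      ih (pd_smooth i hg) fun β => ?_, mderiv_add_single' α i hg, order_add, order_single]
    · ring
    · obtain ⟨B, hB⟩ := hgb (β + Pi.single i 1)
      rw [mderiv_add_single' β i hg] at hB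
      exact ⟨B, hB⟩

end Ultra

namespace Ultra

variable {d : ℕ} {r : Regime} {w : WeightPair}

open NormScale

/-! ### Test functions -/

/-- The estimates `h^{|α|} e^{A(h|x|)} |∂^α f(x)| ≤ K M_{|α|}`. -/
def IsGSBound (w : WeightPair) (h K : ℝ) (f : Rd d → ℂ) : Prop :=
  ∀ α x, h ^ order α * Real.exp (w.assoc (h * ‖x‖)) * ‖mderiv α f x‖ ≤ K * w.M (order α)

theorem gsNorm_le_ofReal_iff {h K : ℝ} (hK : 0 ≤ K) (φ : smoothFun d) :
    gsNorm w h φ ≤ ENNReal.ofReal K ↔ IsGSBound w h K φ.1 := by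
  simp only [gsNorm, iSup_le_iff, IsGSBound]
  refine forall₂_congr fun α x => ?_
  rw [ENNReal.ofReal_le_ofReal_iff hK, div_le_iff₀ (w.M_pos _)]

theorem gsNorm_lt_top_iff {h : ℝ} (φ : smoothFun d) :
    gsNorm w h φ < ⊤ ↔ ∃ K, 0 ≤ K ∧ IsGSBound w h K φ.1 := by
  constructor
  · intro hφ
    refine ⟨(gsNorm w h φ).toReal, ENNReal.toReal_nonneg, ?_⟩
    rw [← gsNorm_le_ofReal_iff ENNReal.toReal_nonneg, ENNReal.ofReal_toReal hφ.ne]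
  · rintro ⟨K, hK, hφ⟩
    exact ((gsNorm_le_ofReal_iff hK φ).2 hφ).trans_lt ENNReal.ofReal_lt_top

/-- The function `f` satisfies the estimates that define the space of test functions. -/
def IsTest (r : Regime) (w : WeightPair) (f : Rd d → ℂ) : Prop :=
  ForLarge r fun h => ∃ K, 0 ≤ K ∧ IsGSBound w h K f

namespace TestSpace

theorem smooth (φ : TestSpace r w d) : ContDiff ℝ ∞ φ.toFun := φ.val.2

theorem isTest (φ : TestSpace r w d) : IsTest r w φ.toFun :=
  ((gsScale w d).forLarge_norm_lt_top φ).mono fun _ _ h => (gsNorm_lt_top_iff _).1 h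

/-- The test function given by a smooth function with suitable estimates. -/
def mk (f : Rd d → ℂ) (hf : ContDiff ℝ ∞ f) (hft : IsTest r w f) : TestSpace r w d :=
  ⟨⟨f, hf⟩, (gsScale w d).mem_carrier_of_forLarge
    (hft.mono fun _ _ h => (gsNorm_lt_top_iff _).2 h)⟩

theorem ext {φ ψ : TestSpace r w d} (h : φ.toFun = ψ.toFun) : φ = ψ :=
  Subtype.ext (Subtype.ext h)

end TestSpace

/-- The factor `2` is the price of the triangle inequality inside the weight: `A(h|x|) ≤ A(2h|x -
y|) + A(2h|y|)`. -/
theorem IsGSBound.translate {h K : ℝ} (hh : 0 < h) {f : Rd d → ℂ}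
    (hs : ContDiff ℝ ∞ f) (hf : IsGSBound w (2 * h) K f) (y : Rd d) :
    IsGSBound w h (K * Real.exp (w.assoc (2 * (h * ‖y‖)))) fun x => f (x - y) := by
  intro α x
  rw [mderiv_translate α y hs]
  have h1 := hf α (x - y)
  have h2 : Real.exp (w.assoc (h * ‖x‖)) ≤
      Real.exp (w.assoc (2 * (h * ‖x - y‖))) * Real.exp (w.assoc (2 * (h * ‖y‖))) := by
    refine le_trans (Real.exp_le_exp.2 (w.assoc_mono (by positivity) ?_))
      (w.exp_assoc_add_le (by positivity) (by positivity))
    rw [← mul_add]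
    gcongr
    simpa using norm_add_le (x - y) y
  rw [mul_pow, mul_assoc 2 h] at h1
  have h3 : (1 : ℝ) ≤ 2 ^ order α := one_le_pow₀ one_le_two
  calc h ^ order α * Real.exp (w.assoc (h * ‖x‖)) * ‖mderiv α f (x - y)‖
      ≤ h ^ order α * (Real.exp (w.assoc (2 * (h * ‖x - y‖))) *
          Real.exp (w.assoc (2 * (h * ‖y‖)))) * ‖mderiv α f (x - y)‖ := by gcongr
    _ = 1 * (h ^ order α * Real.exp (w.assoc (2 * (h * ‖x - y‖))) * ‖mderiv α f (x - y)‖) *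
          Real.exp (w.assoc (2 * (h * ‖y‖))) := by ring
    _ ≤ 2 ^ order α * (h ^ order α * Real.exp (w.assoc (2 * (h * ‖x - y‖))) *
          ‖mderiv α f (x - y)‖) * Real.exp (w.assoc (2 * (h * ‖y‖))) := by gcongr
    _ = 2 ^ order α * h ^ order α * Real.exp (w.assoc (2 * (h * ‖x - y‖))) *
          ‖mderiv α f (x - y)‖ * Real.exp (w.assoc (2 * (h * ‖y‖))) := by ring
    _ ≤ K * w.M (order α) * Real.exp (w.assoc (2 * (h * ‖y‖))) := by gcongr
    _ = _ := by ring

theorem IsTest.translate {f : Rd d → ℂ} (hs : ContDiff ℝ ∞ f) (hf : IsTest r w f) (y : Rd d) :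
    IsTest r w fun x => f (x - y) :=
  (hf.rescale two_pos).mono fun h hh ⟨K, hK, hb⟩ =>
    ⟨K * Real.exp (w.assoc (2 * (h * ‖y‖))), by positivity, hb.translate hh hs y⟩

/-- By (M.2), `M (p + 1)` exceeds `M p` by a geometric factor only, which the passage from `h` to `H
* h` absorbs. -/
theorem IsTest.pd {f : Rd d → ℂ} (hs : ContDiff ℝ ∞ f) (hf : IsTest r w f) (i : Fin d) :
    IsTest r w (pd i f) := by
  obtain ⟨c, H, hc, hH, hM⟩ := w.exists_M_succ_le
  refine (hf.rescale (show 0 < H by positivity)).mono fun h hh ⟨K, hK, hb⟩ =>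
    ⟨K * c / h, by positivity, fun α x => ?_⟩
  have h1 := hb (α + Pi.single i 1) x
  rw [mderiv_add_single' α i hs, order_add, order_single] at h1
  have h2 : Real.exp (w.assoc (h * ‖x‖)) ≤ Real.exp (w.assoc (H * h * ‖x‖)) := by
    refine Real.exp_le_exp.2 (w.assoc_mono (by positivity) ?_)
    gcongr
    exact le_mul_of_one_le_left hh.le hH
  rw [div_mul_eq_mul_div, le_div_iff₀ hh]
  have hHp : 0 < H ^ order α := by positivity
  refine le_of_mul_le_mul_left ?_ hHp
  calc H ^ order α * (h ^ order α * Real.exp (w.assoc (h * ‖x‖)) *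
        ‖mderiv α (Ultra.pd i f) x‖ * h)
      ≤ H ^ order α * (h ^ order α * Real.exp (w.assoc (H * h * ‖x‖)) *
        ‖mderiv α (Ultra.pd i f) x‖ * h) := by gcongr
    _ = 1 * (H ^ order α * h ^ (order α + 1) * Real.exp (w.assoc (H * h * ‖x‖)) *
        ‖mderiv α (Ultra.pd i f) x‖) := by ring
    _ ≤ H * (H ^ order α * h ^ (order α + 1) * Real.exp (w.assoc (H * h * ‖x‖)) *
        ‖mderiv α (Ultra.pd i f) x‖) := by gcongr
    _ = (H * h) ^ (order α + 1) * Real.exp (w.assoc (H * h * ‖x‖)) *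
        ‖mderiv α (Ultra.pd i f) x‖ := by ring
    _ ≤ K * w.M (order α + 1) := h1
    _ ≤ K * (c * H ^ order α * w.M (order α)) := by
      gcongr
      exact hM _
    _ = _ := by ring

theorem IsTest.mderiv {f : Rd d → ℂ} (hs : ContDiff ℝ ∞ f) (hf : IsTest r w f) (α : Fin d → ℕ) :
    IsTest r w (mderiv α f) := by
  induction α using multiIndex_induction with
  | zero => simpa using hf
  | succ α i ih =>
    rw [mderiv_add_single α i hs]
    exact ih.pd (mderiv_smooth α hs) i

theorem IsTest.conj {f : Rd d → ℂ} (hs : ContDiff ℝ ∞ f) (hf : IsTest r w f) :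
    IsTest r w fun x => (starRingEnd ℂ) (f x) :=
  hf.mono fun h _ ⟨K, hK, hb⟩ => ⟨K, hK, fun α x => by
    rw [mderiv_conj α hs, RCLike.norm_conj]
    exact hb α x⟩

theorem IsGSBound.norm_le {h K : ℝ} (hh : 0 < h) {f : Rd d → ℂ} (hb : IsGSBound w h K f)
    (α : Fin d → ℕ) (x : Rd d) : h ^ order α * ‖Ultra.mderiv α f x‖ ≤ K * w.M (order α) := by
  refine le_trans ?_ (hb α x)
  rw [mul_assoc]
  gcongr
  exact le_mul_of_one_le_left (norm_nonneg _) (w.one_le_exp_assoc _)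

theorem IsTest.mul {f g : Rd d → ℂ} (hsf : ContDiff ℝ ∞ f) (hsg : ContDiff ℝ ∞ g)
    (hf : IsTest r w f) (hg : IsTest r w g) : IsTest r w fun x => f x * g x := by
  have key : ∀ h, 0 < h → (∃ K, 0 ≤ K ∧ IsGSBound w (2 * h) K f) →
      (∃ K, 0 ≤ K ∧ IsGSBound w (2 * h) K g) →
      ∃ K, 0 ≤ K ∧ IsGSBound w h K fun x => f x * g x := by
    rintro h hh ⟨K, hK, hKf⟩ ⟨L, hL, hLg⟩
    have h2 : 0 < 2 * h := by positivity
    refine ⟨K * L, by positivity, fun α x => ?_⟩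
    -- All of the decay is taken from `f`: at a fixed `x` its derivatives carry the factor `K / e`,
    -- while those of `g` are only bounded.
    set e := Real.exp (w.assoc (2 * h * ‖x‖)) with he
    have he0 : 0 < e := Real.exp_pos _
    have h1 := norm_mderiv_mul_le w (h := 2 * h) (a := K / e) (b := L) h2 (by positivity) hL
      hsf hsg (x := x) (fun α => by
        rw [div_mul_eq_mul_div, le_div_iff₀ he0]
        exact (le_of_eq (by ring)).trans (hKf α x)) (fun α => hLg.norm_le h2 α x) α
    rw [mul_div_cancel_left₀ _ two_ne_zero, div_mul_eq_mul_div, div_mul_eq_mul_div,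
      le_div_iff₀ he0] at h1
    refine le_trans ?_ h1
    have h3 : Real.exp (w.assoc (h * ‖x‖)) ≤ e :=
      Real.exp_le_exp.2 (w.assoc_mono (by positivity) (by gcongr; linarith))
    calc h ^ order α * Real.exp (w.assoc (h * ‖x‖)) * ‖Ultra.mderiv α (fun x => f x * g x) x‖
        ≤ h ^ order α * e * ‖Ultra.mderiv α (fun x => f x * g x) x‖ := by gcongr
      _ = _ := by ring
  cases r with
  | beurling => exact fun h hh => key h hh (hf _ (by positivity)) (hg _ (by positivity))
  | roumieu =>
    obtain ⟨h, hh, K, hK, hKf⟩ := hf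
    obtain ⟨k, hk, L, hL, hLg⟩ := hg
    have mono : ∀ {a b K : ℝ} {u : Rd d → ℂ}, 0 < a → a ≤ b → IsGSBound w b K u →
        IsGSBound w a K u := by
      intro a b K u ha hab hu α x
      refine le_trans ?_ (hu α x)
      have hb : 0 < b := ha.trans_le hab
      have : w.assoc (a * ‖x‖) ≤ w.assoc (b * ‖x‖) := w.assoc_mono (by positivity) (by gcongr)
      gcongr
    have hm : 0 < min h k := lt_min hh hk
    refine ⟨min h k / 2, by positivity, key _ (by positivity) ⟨K, hK, ?_⟩ ⟨L, hL, ?_⟩⟩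
    · exact mono (by positivity) (by linarith [min_le_left h k]) hKf
    · exact mono (by positivity) (by linarith [min_le_right h k]) hLg

namespace TestSpace

/-- The translate `φ(· - y)` of a test function. -/
def translate (φ : TestSpace r w d) (y : Rd d) : TestSpace r w d :=
  mk (fun x => φ.toFun (x - y)) (contDiff_translate y φ.smooth) (φ.isTest.translate φ.smooth y)

/-- The derivative `∂^α φ` of a test function. -/
def deriv (φ : TestSpace r w d) (α : Fin d → ℕ) : TestSpace r w d :=
  mk (mderiv α φ.toFun) (mderiv_smooth α φ.smooth) (φ.isTest.mderiv φ.smooth α)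

@[simp]
theorem toFun_translate (φ : TestSpace r w d) (y : Rd d) :
    (φ.translate y).toFun = fun x => φ.toFun (x - y) := rfl

@[simp]
theorem toFun_deriv (φ : TestSpace r w d) (α : Fin d → ℕ) :
    (φ.deriv α).toFun = mderiv α φ.toFun := rfl

theorem deriv_translate (φ : TestSpace r w d) (α : Fin d → ℕ) (y : Rd d) :
    (φ.translate y).deriv α = (φ.deriv α).translate y :=
  ext (mderiv_translate α y φ.smooth)

end TestSpace

theorem isTranslate_iff {h : Rd d} {f g : UltraDist r w d} :
    IsTranslate h f g ↔ ∀ φ, g φ = f (φ.translate h) :=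
  ⟨fun H φ => H φ _ rfl, fun H φ ψ hψ => by
    rw [H φ, show ψ = φ.translate h from TestSpace.ext hψ]⟩

theorem isDeriv_iff {α : Fin d → ℕ} {f g : UltraDist r w d} :
    IsDeriv α f g ↔ ∀ φ, g φ = (-1) ^ order α * f (φ.deriv α) :=
  ⟨fun H φ => H φ _ rfl, fun H φ ψ hψ => by
    rw [H φ, show ψ = φ.deriv α from TestSpace.ext hψ]⟩

/-! ### Decay of test functions -/

/-- The integrable weight `(1 + |x|)^{-(d+1)}`. -/
def jap (x : Rd d) : ℝ := ((1 + ‖x‖) ^ (d + 1))⁻¹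

theorem jap_nonneg (x : Rd d) : 0 ≤ jap x := by
  unfold jap
  positivity

theorem integrable_jap : MeasureTheory.Integrable (jap : Rd d → ℝ) := by
  have h := integrable_one_add_norm (E := Rd d) (μ := MeasureTheory.volume) (r := (d + 1 : ℕ))
    (by simp)
  refine h.congr (Eventually.of_forall fun x => ?_)
  simp only [jap]
  rw [Real.rpow_neg (by positivity), Real.rpow_natCast]

/-- A test function and its derivatives are bounded by the weight `jap`. -/
theorem TestSpace.exists_norm_mderiv_le (φ : TestSpace r w d) (α : Fin d → ℕ) :
    ∃ B, 0 ≤ B ∧ ∀ x, ‖mderiv α φ.toFun x‖ ≤ B * jap x := by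
  obtain ⟨k, hk, K, hK, hb⟩ := φ.isTest.exists
  obtain ⟨C, hC, hpow⟩ := w.exists_one_add_pow_le (d + 1) hk
  have hM := w.M_pos (order α)
  refine ⟨C * K * w.M (order α) / k ^ order α, by positivity, fun x => ?_⟩
  have h1 := hb α x
  have h2 := hpow ‖x‖ (norm_nonneg x)
  rw [jap, ← div_eq_mul_inv, le_div_iff₀ (by positivity), le_div_iff₀ (by positivity)]
  calc ‖mderiv α φ.toFun x‖ * (1 + ‖x‖) ^ (d + 1) * k ^ order α
      ≤ ‖mderiv α φ.toFun x‖ * (C * Real.exp (w.assoc (k * ‖x‖))) * k ^ order α := by gcongr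
    _ = C * (k ^ order α * Real.exp (w.assoc (k * ‖x‖)) * ‖mderiv α φ.toFun x‖) := by ring
    _ ≤ C * (K * w.M (order α)) := by gcongr
    _ = _ := by ring

theorem TestSpace.integrable_mderiv (φ : TestSpace r w d) (α : Fin d → ℕ) :
    MeasureTheory.Integrable (mderiv α φ.toFun) := by
  obtain ⟨B, -, hB⟩ := φ.exists_norm_mderiv_le α
  exact (integrable_jap.const_mul B).mono'
    (mderiv_smooth α φ.smooth).continuous.aestronglyMeasurable (Eventually.of_forall hB)

theorem TestSpace.integrable (φ : TestSpace r w d) : MeasureTheory.Integrable φ.toFun := by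
  simpa using φ.integrable_mderiv 0

theorem jap_le_one (x : Rd d) : jap x ≤ 1 :=
  inv_le_one_of_one_le₀ (one_le_pow₀ (by linarith [norm_nonneg x]))

theorem TestSpace.exists_norm_mderiv_le_const (φ : TestSpace r w d) (α : Fin d → ℕ) :
    ∃ B, ∀ x, ‖mderiv α φ.toFun x‖ ≤ B := by
  obtain ⟨B, hB0, hB⟩ := φ.exists_norm_mderiv_le α
  exact ⟨B, fun x => (hB x).trans (mul_le_of_le_one_right hB0 (jap_le_one x))⟩

/-- If there is a nonzero test function, there is one with integral `1`. -/
theorem TestSpace.exists_integral_eq_one {φ : TestSpace r w d} (hφ : φ ≠ 0) :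
    ∃ ψ : TestSpace r w d, ∫ x, ψ.toFun x = 1 := by
  -- The function `|φ|²` is a nonnegative test function with positive integral, which can be
  -- normalized.
  let χ : TestSpace r w d := mk (fun x => φ.toFun x * (starRingEnd ℂ) (φ.toFun x))
    (φ.smooth.mul (contDiff_conj φ.smooth))
    (φ.isTest.mul φ.smooth (contDiff_conj φ.smooth) (φ.isTest.conj φ.smooth))
  have hχ : ∀ x, χ.toFun x = ((‖φ.toFun x‖ ^ 2 : ℝ) : ℂ) := fun x => by
    change φ.toFun x * (starRingEnd ℂ) (φ.toFun x) = _
    rw [Complex.mul_conj, Complex.normSq_eq_norm_sq]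
  obtain ⟨x₀, hx₀⟩ : ∃ x, φ.toFun x ≠ 0 := by
    by_contra! h
    exact hφ (ext (funext h))
  have hcont : Continuous fun x => ‖φ.toFun x‖ ^ 2 := by
    have := φ.smooth.continuous
    fun_prop
  have hint : MeasureTheory.Integrable fun x => ‖φ.toFun x‖ ^ 2 := by
    have := χ.integrable.re
    simpa [hχ, ← Complex.ofReal_pow] using this
  have hpos : 0 < ∫ x, ‖φ.toFun x‖ ^ 2 := by
    rw [MeasureTheory.integral_pos_iff_support_of_nonneg (fun x => by positivity) hint]
    refine IsOpen.measure_pos _ hcont.isOpen_support ⟨x₀, ?_⟩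
    simpa using hx₀
  have hI : ∫ x, χ.toFun x = ((∫ x, ‖φ.toFun x‖ ^ 2 : ℝ) : ℂ) := by
    simp_rw [hχ]
    exact integral_ofReal
  refine ⟨(∫ x, χ.toFun x)⁻¹ • χ, ?_⟩
  have hne : ∫ x, χ.toFun x ≠ 0 := by
    rw [hI]
    exact_mod_cast hpos.ne'
  change ∫ x, (∫ x, χ.toFun x)⁻¹ * χ.toFun x = 1
  rw [MeasureTheory.integral_const_mul, inv_mul_cancel₀ hne]

/-! ### Continuity of translations on test functions -/

theorem norm_fderiv_le_sum_pd (f : Rd d → ℂ) (x : Rd d) : ‖fderiv ℝ f x‖ ≤ ∑ i, ‖pd i f x‖ := by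
  refine ContinuousLinearMap.opNorm_le_bound _ (Finset.sum_nonneg fun i _ => norm_nonneg _)
    fun v => ?_
  have hv : v = ∑ i, v i • EuclideanSpace.single i (1 : ℝ) := by
    simpa using ((EuclideanSpace.basisFun (Fin d) ℝ).sum_repr v).symm
  have e : fderiv ℝ f x v = ∑ i, v i • pd i f x := by
    conv_lhs => rw [hv]
    simp [pd]
  rw [e, Finset.sum_mul]
  refine (norm_sum_le _ _).trans (Finset.sum_le_sum fun i _ => ?_)
  rw [norm_smul, mul_comm]
  gcongr
  exact PiLp.norm_apply_le v i

/-- The mean value inequality on the unit ball around `x`. In the dilation `2 * H`, the `H` pays for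
the one additional derivative and the `2` for comparing the weights at two points at distance at
most `1`; the factor `d` counts the partial derivatives. -/
theorem IsTest.translate_sub {f : Rd d → ℂ} (hs : ContDiff ℝ ∞ f) (hf : IsTest r w f) :
    ForLarge r fun h => ∃ C, 0 ≤ C ∧ ∀ z : Rd d, ‖z‖ ≤ 1 →
      IsGSBound w h (C * ‖z‖) ((fun x => f (x - z)) - f) := by
  obtain ⟨c, H, hc, hH, hM⟩ := w.exists_M_succ_le
  refine (hf.rescale (show 0 < 2 * H by positivity)).mono fun h hh ⟨K, hK, hb⟩ => ?_
  refine ⟨d * (Real.exp (w.assoc (2 * h)) * K * c / h), by positivity, fun z hz α x => ?_⟩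
  rw [mderiv_sub α (contDiff_translate z hs) hs, mderiv_translate α z hs, Pi.sub_apply]
  set W := h ^ order α * Real.exp (w.assoc (h * ‖x‖)) with hW
  have hW0 : 0 < W := by positivity
  have hMp := w.M_pos (order α)
  have hbound : ∀ u ∈ Metric.closedBall x 1, ‖fderiv ℝ (Ultra.mderiv α f) u‖ ≤
      d * (Real.exp (w.assoc (2 * h)) * K * c / h * w.M (order α) / W) := by
    intro u hu
    refine (norm_fderiv_le_sum_pd _ _).trans ?_
    have : ∀ i ∈ Finset.univ, ‖Ultra.pd i (Ultra.mderiv α f) u‖ ≤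
        Real.exp (w.assoc (2 * h)) * K * c / h * w.M (order α) / W := by
      intro i _
      rw [le_div_iff₀ hW0, div_mul_eq_mul_div, le_div_iff₀ hh, ← mderiv_add_single α i hs]
      have h1 := hb (α + Pi.single i 1) u
      rw [order_add, order_single] at h1
      have h2 : Real.exp (w.assoc (h * ‖x‖)) ≤
          Real.exp (w.assoc (2 * H * h * ‖u‖)) * Real.exp (w.assoc (2 * h)) := by
        have hxu : ‖x‖ ≤ ‖u‖ + 1 := by
          rw [mem_closedBall_iff_norm'] at hu
          have := norm_add_le u (x - u)
          rw [add_sub_cancel] at this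
          linarith
        refine le_trans (Real.exp_le_exp.2 (w.assoc_mono (ρ' := h * ‖u‖ + h) (by positivity) ?_))
          ((w.exp_assoc_add_le (by positivity) (by positivity)).trans ?_)
        · nlinarith
        · gcongr
          refine w.assoc_mono (by positivity) ?_
          calc 2 * (h * ‖u‖) = 2 * 1 * h * ‖u‖ := by ring
            _ ≤ 2 * H * h * ‖u‖ := by gcongr
      set n := ‖Ultra.mderiv (α + Pi.single i 1) f u‖ with hn
      have hHp : 0 < H ^ order α := by positivity
      refine le_of_mul_le_mul_left ?_ hHp
      calc H ^ order α * (n * W * h)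
          ≤ H ^ order α * (n * (h ^ order α * (Real.exp (w.assoc (2 * H * h * ‖u‖)) *
              Real.exp (w.assoc (2 * h)))) * h) := by
            rw [hW]
            gcongr
        _ = Real.exp (w.assoc (2 * h)) * (1 * (H ^ order α * h ^ (order α + 1) *
              Real.exp (w.assoc (2 * H * h * ‖u‖)) * n)) := by ring
        _ ≤ Real.exp (w.assoc (2 * h)) * (2 ^ (order α + 1) * H * (H ^ order α *
              h ^ (order α + 1) * Real.exp (w.assoc (2 * H * h * ‖u‖)) * n)) := by
            gcongr
            exact one_le_mul_of_one_le_of_one_le (one_le_pow₀ one_le_two) hH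
        _ = Real.exp (w.assoc (2 * h)) * ((2 * H * h) ^ (order α + 1) *
              Real.exp (w.assoc (2 * H * h * ‖u‖)) * n) := by ring
        _ ≤ Real.exp (w.assoc (2 * h)) * (K * (c * H ^ order α * w.M (order α))) := by
            refine mul_le_mul_of_nonneg_left (h1.trans ?_) (Real.exp_pos _).le
            gcongr
            exact hM _
        _ = _ := by ring
    refine (Finset.sum_le_sum this).trans (le_of_eq ?_)
    simp
  have hmv := (convex_closedBall x 1).norm_image_sub_le_of_norm_fderiv_le (𝕜 := ℝ)
    (fun u _ => differentiable_of_smooth (mderiv_smooth α hs) u) hbound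
    (Metric.mem_closedBall_self zero_le_one) (show x - z ∈ Metric.closedBall x 1 by simpa using hz)
  rw [show ‖x - z - x‖ = ‖z‖ by simp] at hmv
  calc W * ‖Ultra.mderiv α f (x - z) - Ultra.mderiv α f x‖
      ≤ W * (d * (Real.exp (w.assoc (2 * h)) * K * c / h * w.M (order α) / W) * ‖z‖) := by gcongr
    _ = _ := by field_simp

theorem TestSpace.continuous_translate (φ : TestSpace r w d) :
    Continuous fun y => φ.translate y := by
  rw [continuous_iff_continuousAt]
  intro y₀
  refine (gsScale w d).tendsto_of_forLarge ?_
  -- Since `φ(· - y) = ψ(· - (y - y₀))`, continuity at `y₀` for `φ` becomes continuity at `0` for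
  -- `ψ`.
  set ψ := φ.translate y₀ with hψ
  refine (ψ.isTest.translate_sub ψ.smooth).mono fun h hh ⟨C, hC, hb⟩ => ?_
  have hz : Tendsto (fun y => ENNReal.ofReal (C * ‖y - y₀‖)) (𝓝 y₀) (𝓝 0) := by
    have : Continuous fun y : Rd d => ENNReal.ofReal (C * ‖y - y₀‖) :=
      ENNReal.continuous_ofReal.comp (by fun_prop)
    simpa using this.tendsto y₀
  refine tendsto_of_tendsto_of_tendsto_of_le_of_le' tendsto_const_nhds hz
    (Eventually.of_forall fun _ => bot_le) ?_
  filter_upwards [Metric.closedBall_mem_nhds y₀ one_pos] with y hy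
  have h1 := hb (y - y₀) (by simpa [dist_eq_norm] using hy)
  refine (gsNorm_le_ofReal_iff (by positivity) _).2 ?_
  have e : (φ.translate y - ψ).val.1 = (fun x => ψ.toFun (x - (y - y₀))) - ψ.toFun := by
    funext x
    change φ.toFun (x - y) - φ.toFun (x - y₀) =
      φ.toFun (x - (y - y₀) - y₀) - φ.toFun (x - y₀)
    rw [sub_sub x, sub_add_cancel]
  rw [e]
  exact h1

end Ultra

namespace Ultra

variable {d : ℕ} {r : Regime} {w : WeightPair}

open NormScale MeasureTheory

namespace TranslationInvariant

variable {E : Type*} [NormedAddCommGroup E] [NormedSpace ℂ E] (T : TranslationInvariant r w d E)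

/-! ### Translations on `E` -/

theorem ext_toUltra {e g : E} (h : ∀ φ, T.toUltra e φ = T.toUltra g φ) : e = g :=
  T.toUltra_injective (ContinuousLinearMap.ext h)

/-- The pairing with a test function. -/
def pairing (φ : TestSpace r w d) : E →L[ℂ] ℂ where
  toFun e := T.toUltra e φ
  map_add' a b := by simp
  map_smul' c a := by simp
  cont := (continuous_eval_const φ).comp T.toUltra.continuous

@[simp]
theorem pairing_apply (φ : TestSpace r w d) (e : E) : T.pairing φ e = T.toUltra e φ := rfl

theorem exists_shift (y : Rd d) (e : E) :
    ∃ g, ∀ φ, T.toUltra g φ = T.toUltra e (φ.translate (-y)) := by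
  obtain ⟨g, hg⟩ := T.exists_translate (-y) e
  exact ⟨g, isTranslate_iff.1 hg⟩

/-- The translate `e(· - y)` of `e ∈ E`. -/
def shift (y : Rd d) : E →ₗ[ℂ] E where
  toFun e := (T.exists_shift y e).choose
  map_add' a b := T.ext_toUltra fun φ => by
    refine ((T.exists_shift y (a + b)).choose_spec φ).trans ?_
    rw [map_add T.toUltra a b, add_apply, map_add T.toUltra, add_apply,
      (T.exists_shift y a).choose_spec, (T.exists_shift y b).choose_spec]
  map_smul' c a := T.ext_toUltra fun φ => by
    refine ((T.exists_shift y (c • a)).choose_spec φ).trans ?_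
    rw [RingHom.id_apply, map_smul T.toUltra c a, smul_apply, map_smul T.toUltra, smul_apply,
      (T.exists_shift y a).choose_spec]

theorem toUltra_shift (y : Rd d) (e : E) (φ : TestSpace r w d) :
    T.toUltra (T.shift y e) φ = T.toUltra e (φ.translate (-y)) :=
  (T.exists_shift y e).choose_spec φ

theorem shift_zero (e : E) : T.shift 0 e = e :=
  T.ext_toUltra fun φ => by
    rw [toUltra_shift]
    congr 1
    exact TestSpace.ext (by simp)

theorem shift_ofTest (y : Rd d) (ψ : TestSpace r w d) :
    T.shift y (T.ofTest ψ) = T.ofTest (ψ.translate y) :=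
  T.ext_toUltra fun φ => by
    rw [toUltra_shift, T.toUltra_ofTest, T.toUltra_ofTest,
      ← integral_sub_right_eq_self (fun x => ψ.toFun x * (φ.translate (-y)).toFun x) y]
    simp

/-- Translations on `E` have moderate growth, and for each test function there is some rate of
growth that is compensated by the decay of its derivatives. -/
theorem exists_growth (φ : TestSpace r w d) : ∃ τ C : ℝ, 0 < τ ∧ 0 < C ∧
    (∀ y e, ‖T.shift y e‖ ≤ C * Real.exp (w.assoc (τ * ‖y‖)) * ‖e‖) ∧
    ForLarge r fun m => ∃ B, 0 ≤ B ∧ ∀ α x, m ^ order α *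
      (‖mderiv α φ.toFun x‖ * Real.exp (w.assoc (τ * ‖x‖))) ≤ B * w.M (order α) * jap x := by
  obtain ⟨H, hH, hdom⟩ := w.exists_exp_assoc_mul_pow_le (d + 1)
  have hH0 : 0 < H := by positivity
  have decay : ∀ τ, 0 < τ → ∀ m k, 0 < m → m ≤ k → H * τ ≤ k →
      (∃ K, 0 ≤ K ∧ IsGSBound w k K φ.toFun) → ∃ B, 0 ≤ B ∧ ∀ α x, m ^ order α *
      (‖mderiv α φ.toFun x‖ * Real.exp (w.assoc (τ * ‖x‖))) ≤ B * w.M (order α) * jap x := by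
    rintro τ hτ m k hm hmk hτk ⟨K, hK, hb⟩
    obtain ⟨C, hC, hpow⟩ := hdom τ hτ
    refine ⟨C * K, by positivity, fun α x => ?_⟩
    rw [jap, ← div_eq_mul_inv, le_div_iff₀ (by positivity)]
    calc m ^ order α * (‖mderiv α φ.toFun x‖ * Real.exp (w.assoc (τ * ‖x‖))) *
          (1 + ‖x‖) ^ (d + 1)
        = m ^ order α * ‖mderiv α φ.toFun x‖ *
          (Real.exp (w.assoc (τ * ‖x‖)) * (1 + ‖x‖) ^ (d + 1)) := by ring
      _ ≤ k ^ order α * ‖mderiv α φ.toFun x‖ * (C * Real.exp (w.assoc (k * ‖x‖))) := by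
        have hk : 0 < k := hm.trans_le hmk
        have := hpow k hτk _ (norm_nonneg x)
        gcongr
      _ = C * (k ^ order α * Real.exp (w.assoc (k * ‖x‖)) * ‖mderiv α φ.toFun x‖) := by ring
      _ ≤ C * (K * w.M (order α)) := by
        exact mul_le_mul_of_nonneg_left (hb α x) hC.le
      _ = C * K * w.M (order α) := by ring
  have htr : ∀ y e, IsTranslate (-y) (T.toUltra e) (T.toUltra (T.shift y e)) := fun y e =>
    isTranslate_iff.2 (T.toUltra_shift y e)
  -- The order of choices differs. Beurling: `τ` is given by `E`, and `φ` decays at the rate `max m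
  -- (H * τ)`. Roumieu: `φ` decays at some rate `k`, and the growth condition is then used with `τ =
  -- k / H`.
  cases r with
  | beurling =>
    obtain ⟨τ, C, hτ, hC, hg⟩ := T.growth
    refine ⟨τ, C, hτ, hC, fun y e => hg y e _ (htr y e), fun m hm => ?_⟩
    have hk : 0 < max m (H * τ) := lt_max_of_lt_left hm
    exact decay τ hτ m _ hm (le_max_left _ _) (le_max_right _ _) (φ.isTest _ hk)
  | roumieu =>
    obtain ⟨k, hk, hφ⟩ := φ.isTest
    have hτ : 0 < k / H := by positivity
    obtain ⟨C, hC, hg⟩ := T.growth (k / H) hτ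
    refine ⟨k / H, C, hτ, hC, fun y e => hg y e _ (htr y e), k, hk, ?_⟩
    exact decay _ hτ k k hk le_rfl (mul_div_cancel₀ _ hH0.ne').le hφ

/-- Translations are continuous on the dense image of the test functions, and the growth bound makes
them locally equicontinuous, so that continuity passes to the closure. The zero test function serves
only to extract the growth bound. -/
theorem continuous_shift (e : E) : Continuous fun y => T.shift y e := by
  obtain ⟨τ, C, hτ, hC, hg, -⟩ := T.exists_growth 0
  rw [continuous_iff_continuousAt]
  intro y₀
  refine continuousAt_of_locally_uniform_approx_of_continuousAt fun u hu => ?_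
  obtain ⟨ε, hε, hεu⟩ := Metric.mem_uniformity_dist.1 hu
  set D := C * Real.exp (w.assoc (τ * (‖y₀‖ + 1))) with hD
  have hD0 : 0 < D := by positivity
  obtain ⟨ψ, hψ⟩ := T.denseRange_ofTest.exists_dist_lt e (show 0 < ε / D by positivity)
  refine ⟨Metric.ball y₀ 1, Metric.ball_mem_nhds _ one_pos, fun y => T.shift y (T.ofTest ψ), ?_,
    fun y hy => hεu ?_⟩
  · simp_rw [T.shift_ofTest]
    exact (T.ofTest.continuous.comp ψ.continuous_translate).continuousAt
  · rw [dist_eq_norm, ← map_sub]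
    refine (hg y _).trans_lt ?_
    have hy' : ‖y‖ ≤ ‖y₀‖ + 1 := by
      rw [mem_ball_iff_norm] at hy
      have := norm_add_le y₀ (y - y₀)
      rw [add_sub_cancel] at this
      linarith
    have h1 : C * Real.exp (w.assoc (τ * ‖y‖)) ≤ D := by
      rw [hD]
      have : w.assoc (τ * ‖y‖) ≤ w.assoc (τ * (‖y₀‖ + 1)) :=
        w.assoc_mono (by positivity) (by gcongr)
      gcongr
    rw [dist_eq_norm, lt_div_iff₀ hD0] at hψ
    calc C * Real.exp (w.assoc (τ * ‖y‖)) * ‖e - T.ofTest ψ‖ ≤ D * ‖e - T.ofTest ψ‖ := by gcongr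
      _ < ε := by linarith

/-! ### Regularization -/

/-- The regularization `∫ f(y) e(· - ε y) dy` of `e ∈ E`. -/
def reg (f : Rd d → ℂ) (ε : ℝ) (e : E) : E := ∫ y, f y • T.shift (ε • y) e

/-- Decay of `f` which makes the regularization with `f` converge, for translations that grow at
most like `e^{A(τ|·|)}`. -/
def HasDecay (w : WeightPair) (τ B : ℝ) (f : Rd d → ℂ) : Prop :=
  Continuous f ∧ ∀ x, ‖f x‖ * Real.exp (w.assoc (τ * ‖x‖)) ≤ B * jap x

section Reg

variable {T} {τ C B ε : ℝ} {f : Rd d → ℂ}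

/-- Because `ε ≤ 1`, the weight at `ε • y` is at most that at `y`; the integrable majorant is thus
the same for all `ε`. -/
theorem norm_smul_shift_le (hτ : 0 < τ) (hC : 0 < C)
    (hg : ∀ y e, ‖T.shift y e‖ ≤ C * Real.exp (w.assoc (τ * ‖y‖)) * ‖e‖)
    (hf : HasDecay w τ B f) (hε0 : 0 ≤ ε) (hε1 : ε ≤ 1) (e : E) (y : Rd d) :
    ‖f y • T.shift (ε • y) e‖ ≤ C * B * ‖e‖ * jap y := by
  have h1 : w.assoc (τ * ‖ε • y‖) ≤ w.assoc (τ * ‖y‖) := by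
    refine w.assoc_mono (by positivity) ?_
    rw [norm_smul, Real.norm_of_nonneg hε0]
    gcongr
    exact mul_le_of_le_one_left (norm_nonneg y) hε1
  rw [norm_smul]
  calc ‖f y‖ * ‖T.shift (ε • y) e‖ ≤ ‖f y‖ * (C * Real.exp (w.assoc (τ * ‖y‖)) * ‖e‖) := by
        gcongr
        exact (hg _ _).trans (by gcongr)
    _ = C * ‖e‖ * (‖f y‖ * Real.exp (w.assoc (τ * ‖y‖))) := by ring
    _ ≤ C * ‖e‖ * (B * jap y) := by
        exact mul_le_mul_of_nonneg_left (hf.2 y) (by positivity)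
    _ = _ := by ring

theorem integrable_smul_shift (hτ : 0 < τ) (hC : 0 < C)
    (hg : ∀ y e, ‖T.shift y e‖ ≤ C * Real.exp (w.assoc (τ * ‖y‖)) * ‖e‖)
    (hf : HasDecay w τ B f) (hε0 : 0 ≤ ε) (hε1 : ε ≤ 1) (e : E) :
    Integrable fun y => f y • T.shift (ε • y) e :=
  (integrable_jap.const_mul (C * B * ‖e‖)).mono'
    (hf.1.smul ((T.continuous_shift e).comp (by fun_prop))).aestronglyMeasurable
    (Eventually.of_forall (norm_smul_shift_le hτ hC hg hf hε0 hε1 e))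

theorem norm_reg_le (hτ : 0 < τ) (hC : 0 < C)
    (hg : ∀ y e, ‖T.shift y e‖ ≤ C * Real.exp (w.assoc (τ * ‖y‖)) * ‖e‖)
    (hf : HasDecay w τ B f) (hε0 : 0 ≤ ε) (hε1 : ε ≤ 1) (e : E) :
    ‖T.reg f ε e‖ ≤ C * B * (∫ y : Rd d, jap y) * ‖e‖ := by
  refine (norm_integral_le_of_norm_le (integrable_jap.const_mul (C * B * ‖e‖))
    (Eventually.of_forall (norm_smul_shift_le hτ hC hg hf hε0 hε1 e))).trans (le_of_eq ?_)
  rw [integral_const_mul]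
  ring

theorem reg_add (hτ : 0 < τ) (hC : 0 < C)
    (hg : ∀ y e, ‖T.shift y e‖ ≤ C * Real.exp (w.assoc (τ * ‖y‖)) * ‖e‖)
    (hf : HasDecay w τ B f) (hε0 : 0 ≤ ε) (hε1 : ε ≤ 1) (a b : E) :
    T.reg f ε (a + b) = T.reg f ε a + T.reg f ε b := by
  simp only [reg, map_add, smul_add]
  exact integral_add (integrable_smul_shift hτ hC hg hf hε0 hε1 a)
    (integrable_smul_shift hτ hC hg hf hε0 hε1 b)

theorem reg_smul (f : Rd d → ℂ) (ε : ℝ) (c : ℂ) (a : E) : T.reg f ε (c • a) = c • T.reg f ε a := by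
  simp only [reg, map_smul]
  rw [← integral_smul]
  congr 1
  funext y
  rw [smul_comm]

variable [CompleteSpace E]

theorem toUltra_reg (hτ : 0 < τ) (hC : 0 < C)
    (hg : ∀ y e, ‖T.shift y e‖ ≤ C * Real.exp (w.assoc (τ * ‖y‖)) * ‖e‖)
    (hf : HasDecay w τ B f) (hε0 : 0 ≤ ε) (hε1 : ε ≤ 1) (e : E) (ψ : TestSpace r w d) :
    T.toUltra (T.reg f ε e) ψ = ∫ y, f y * T.toUltra e (ψ.translate (-(ε • y))) := by
  rw [← pairing_apply, reg, ← ContinuousLinearMap.integral_comp_comm _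
    (integrable_smul_shift hτ hC hg hf hε0 hε1 e)]
  simp [toUltra_shift]

/-- Regularization commutes with derivatives. -/
theorem isDeriv_reg_reg (hτ : 0 < τ) (hC : 0 < C)
    (hg : ∀ y e, ‖T.shift y e‖ ≤ C * Real.exp (w.assoc (τ * ‖y‖)) * ‖e‖)
    (hf : HasDecay w τ B f) (hε0 : 0 ≤ ε) (hε1 : ε ≤ 1) {α : Fin d → ℕ} {e g : E}
    (h : IsDeriv α (T.toUltra e) (T.toUltra g)) :
    IsDeriv α (T.toUltra (T.reg f ε e)) (T.toUltra (T.reg f ε g)) := by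
  rw [isDeriv_iff] at h ⊢
  intro ψ
  rw [toUltra_reg hτ hC hg hf hε0 hε1, toUltra_reg hτ hC hg hf hε0 hε1, ← integral_const_mul]
  congr 1
  funext y
  rw [h, TestSpace.deriv_translate]
  ring

/-- Dominated convergence: the integrand tends to `f y • e` by strong continuity of translations. -/
theorem tendsto_reg (hτ : 0 < τ) (hC : 0 < C)
    (hg : ∀ y e, ‖T.shift y e‖ ≤ C * Real.exp (w.assoc (τ * ‖y‖)) * ‖e‖)
    (hf : HasDecay w τ B f) (hf1 : ∫ y, f y = 1) {ε : ℕ → ℝ} (hε0 : ∀ n, 0 ≤ ε n)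
    (hε1 : ∀ n, ε n ≤ 1) (hε : Tendsto ε atTop (𝓝 0)) (e : E) :
    Tendsto (fun n => T.reg f (ε n) e) atTop (𝓝 e) := by
  have hlim : Tendsto (fun n => T.reg f (ε n) e) atTop (𝓝 (∫ y, f y • e)) := by
    refine tendsto_integral_of_dominated_convergence (fun y => C * B * ‖e‖ * jap y)
      (fun n => (integrable_smul_shift hτ hC hg hf (hε0 n) (hε1 n) e).aestronglyMeasurable)
      (integrable_jap.const_mul _) (fun n => Eventually.of_forall
        (norm_smul_shift_le hτ hC hg hf (hε0 n) (hε1 n) e)) (Eventually.of_forall fun y => ?_)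
    have h1 : Tendsto (fun n => T.shift (ε n • y) e) atTop (𝓝 (T.shift ((0 : ℝ) • y) e)) :=
      ((T.continuous_shift e).tendsto _).comp (hε.smul_const y)
    rw [zero_smul, shift_zero] at h1
    exact h1.const_smul (f y)
  rwa [integral_smul_const, hf1, one_smul] at hlim

theorem integral_translate_swap {f : Rd d → ℂ} (hf : Integrable f) (χ ψ : TestSpace r w d) (ε : ℝ) :
    ∫ y, f y * ∫ x, χ.toFun x * ψ.toFun (x + ε • y) =
      ∫ x, χ.toFun x * ∫ y, f y * ψ.toFun (x + ε • y) := by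
  simp_rw [← integral_const_mul]
  rw [integral_integral_swap]
  · congr 1
    funext x
    congr 1
    funext y
    ring
  · obtain ⟨K, hK⟩ := ψ.exists_norm_mderiv_le_const 0
    rw [mderiv_zero] at hK
    have hc : Continuous fun p : Rd d × Rd d => ψ.toFun (p.2 + ε • p.1) :=
      ψ.smooth.continuous.comp (by fun_prop)
    have := (hf.mul_prod χ.integrable).mul_bdd hc.aestronglyMeasurable
      (Eventually.of_forall fun p => hK _)
    refine this.congr (Eventually.of_forall fun p => ?_)
    simp only [Function.uncurry, mul_assoc]

/-- The derivatives of a regularization, as regularizations with the derivatives of the kernel. -/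
theorem isDeriv_reg (hτ : 0 < τ) (hC : 0 < C)
    (hg : ∀ y e, ‖T.shift y e‖ ≤ C * Real.exp (w.assoc (τ * ‖y‖)) * ‖e‖)
    (φ : TestSpace r w d) (hφ : ∀ α, ∃ B, HasDecay w τ B (mderiv α φ.toFun))
    (hε0 : 0 < ε) (hε1 : ε ≤ 1) (α : Fin d → ℕ) (e : E) :
    IsDeriv α (T.toUltra (T.reg φ.toFun ε e))
      (T.toUltra (((ε : ℂ) ^ order α)⁻¹ • T.reg (mderiv α φ.toFun) ε e)) := by
  have hεC : (ε : ℂ) ^ order α ≠ 0 := pow_ne_zero _ (by exact_mod_cast hε0.ne')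
  obtain ⟨B₀, h0⟩ := hφ 0
  rw [mderiv_zero] at h0
  obtain ⟨B, hB⟩ := hφ α
  have hcont : ∀ {f : Rd d → ℂ} {B : ℝ}, HasDecay w τ B f → Continuous (T.reg f ε) := by
    intro f B hf
    let L : E →ₗ[ℂ] E :=
      { toFun := T.reg f ε
        map_add' := reg_add hτ hC hg hf hε0.le hε1
        map_smul' := reg_smul f ε }
    exact (L.mkContinuous _ (norm_reg_le hτ hC hg hf hε0.le hε1)).continuous
  rw [isDeriv_iff]
  intro ψ
  -- Both sides are continuous in `e`, so it is enough to take `e` a test function `χ`, for which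
  -- the pairings are integrals and Fubini applies.
  have hclosed : IsClosed {e : E | T.toUltra (((ε : ℂ) ^ order α)⁻¹ • T.reg (mderiv α φ.toFun) ε e) ψ
      = (-1) ^ order α * T.toUltra (T.reg φ.toFun ε e) (ψ.deriv α)} := by
    refine isClosed_eq ?_ ?_
    · exact (T.pairing ψ).continuous.comp ((hcont hB).const_smul _)
    · exact continuous_const.mul ((T.pairing (ψ.deriv α)).continuous.comp (hcont h0))
  refine T.denseRange_ofTest.induction_on (p := fun e =>
    T.toUltra (((ε : ℂ) ^ order α)⁻¹ • T.reg (mderiv α φ.toFun) ε e) ψ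
      = (-1) ^ order α * T.toUltra (T.reg φ.toFun ε e) (ψ.deriv α)) e hclosed fun χ => ?_
  rw [map_smul, smul_apply, smul_eq_mul, toUltra_reg hτ hC hg hB hε0.le hε1,
    toUltra_reg hτ hC hg h0 hε0.le hε1, inv_mul_eq_iff_eq_mul₀ hεC]
  simp only [T.toUltra_ofTest, TestSpace.toFun_translate, TestSpace.toFun_deriv, sub_neg_eq_add]
  rw [integral_translate_swap (φ.integrable_mderiv α) χ ψ ε,
    show ∫ y, φ.toFun y * ∫ x, χ.toFun x * mderiv α ψ.toFun (x + ε • y) =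
      ∫ x, χ.toFun x * ∫ y, φ.toFun y * mderiv α ψ.toFun (x + ε • y) from
      integral_translate_swap φ.integrable χ (ψ.deriv α) ε, ← integral_const_mul,
    ← integral_const_mul]
  congr 1
  funext x
  -- Integration by parts in `y`: differentiating `y ↦ ψ(x + ε • y)` produces `ε ^ order α`, which
  -- the prefactor of the regularization cancels, and the sign is that of the distributional
  -- derivative.
  have hibp := integral_mderiv_mul α φ.smooth (contDiff_affine x ε ψ.smooth)
    φ.integrable_mderiv (fun β => by
      obtain ⟨K, hK⟩ := ψ.exists_norm_mderiv_le_const β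
      refine ⟨‖(ε : ℂ) ^ order β‖ * K, fun y => ?_⟩
      rw [mderiv_affine β x ε ψ.smooth, norm_mul]
      gcongr
      exact hK _)
  rw [hibp, mderiv_affine α x ε ψ.smooth]
  have e1 : ∀ y, φ.toFun y * ((ε : ℂ) ^ order α * mderiv α ψ.toFun (x + ε • y)) =
      (ε : ℂ) ^ order α * (φ.toFun y * mderiv α ψ.toFun (x + ε • y)) := fun y => by ring
  simp_rw [e1]
  rw [integral_const_mul]
  ring

end Reg

/-! ### The norms of `D^*_E` -/

theorem eq_of_isDeriv {α : Fin d → ℕ} {e g g' : E} (h : IsDeriv α (T.toUltra e) (T.toUltra g))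
    (h' : IsDeriv α (T.toUltra e) (T.toUltra g')) : g = g' :=
  T.ext_toUltra fun φ => by rw [isDeriv_iff.1 h, isDeriv_iff.1 h']

theorem derivNorm_le_ofReal {m K : ℝ} {e : E} (h : ∀ α, ∃ g, IsDeriv α (T.toUltra e) (T.toUltra g) ∧
    m ^ order α * ‖g‖ ≤ K * w.M (order α)) : T.derivNorm m e ≤ ENNReal.ofReal K := by
  refine iSup_le fun α => ?_
  obtain ⟨g, hg, hK⟩ := h α
  refine iInf_le_of_le ⟨g, hg⟩ (ENNReal.ofReal_le_ofReal ?_)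
  rwa [div_le_iff₀ (w.M_pos _)]

/-- A missing derivative would give an infimum over the empty set, that is `⊤`; otherwise the
infimum runs over a single element and is attained. -/
theorem exists_isDeriv {m : ℝ} {e : E} (h : T.derivNorm m e < ⊤) (α : Fin d → ℕ) :
    ∃ g, IsDeriv α (T.toUltra e) (T.toUltra g) ∧
      m ^ order α * ‖g‖ ≤ (T.derivNorm m e).toReal * w.M (order α) := by
  have h1 : ⨅ g : {g : E // IsDeriv α (T.toUltra e) (T.toUltra g)},
      ENNReal.ofReal (m ^ order α * ‖g.1‖ / w.M (order α)) ≤ T.derivNorm m e :=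
    le_iSup (fun α : Fin d → ℕ => ⨅ g : {g : E // IsDeriv α (T.toUltra e) (T.toUltra g)},
      ENNReal.ofReal (m ^ order α * ‖g.1‖ / w.M (order α))) α
  obtain ⟨g, hg⟩ : ∃ g, IsDeriv α (T.toUltra e) (T.toUltra g) := by
    by_contra! hc
    have : IsEmpty {g : E // IsDeriv α (T.toUltra e) (T.toUltra g)} :=
      ⟨fun g => hc g.1 g.2⟩
    rw [iInf_of_empty] at h1
    exact h.not_ge h1
  refine ⟨g, hg, ?_⟩
  rw [← div_le_iff₀ (w.M_pos _), ← ENNReal.ofReal_le_iff_le_toReal h.ne]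
  refine le_trans (le_iInf fun g' => ?_) h1
  rw [T.eq_of_isDeriv hg g'.2]

theorem isDeriv_zero_iff {e g : E} : IsDeriv 0 (T.toUltra e) (T.toUltra g) ↔ e = g := by
  rw [isDeriv_iff]
  have : ∀ φ : TestSpace r w d, φ.deriv 0 = φ := fun φ => TestSpace.ext (by simp)
  simp only [this, order_zero, pow_zero, one_mul]
  exact ⟨fun h => T.ext_toUltra fun φ => (h φ).symm, fun h φ => by rw [h]⟩

theorem enorm_le_derivNorm (m : ℝ) (e : E) : ‖e‖ₑ ≤ T.derivNorm m e := by
  refine le_trans ?_ (le_iSup _ (0 : Fin d → ℕ))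
  refine le_iInf fun g => ?_
  rw [← T.isDeriv_zero_iff.1 g.2, ← ofReal_norm]
  simp [w.M_zero]

end TranslationInvariant

end Ultra

/-! ### Approximate factorization of the identities, and the conclusion -/

namespace Ultra

variable {d : ℕ} {r : Regime} {w : WeightPair}

open NormScale MeasureTheory

namespace TranslationInvariant

variable {E : Type*} [NormedAddCommGroup E] [NormedSpace ℂ E] (T : TranslationInvariant r w d E)

/-- The continuous inclusion of `D^*_E` in `E`. -/
def incl : T.D →L[ℂ] E where
  toFun e := e.val
  map_add' _ _ := rfl
  map_smul' _ _ := rfl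
  cont := by
    let f : T.D →ₗ[ℂ] E :=
      { toFun := fun e => e.val
        map_add' := fun _ _ => rfl
        map_smul' := fun _ _ => rfl }
    have key : ∀ m (e : T.D), ENNReal.ofReal (((normSeminorm ℂ E).comp f) e) ≤
        (1 : ℝ≥0) * T.derivNorm m e.val := fun m e => by
      rw [ENNReal.coe_one, one_mul]
      refine le_trans (le_of_eq ?_) (T.enorm_le_derivNorm m e.val)
      exact ofReal_norm e.val
    refine T.derivScale.continuous_of_comp_mem f ?_
    cases r with
    | beurling => exact ⟨1, one_pos, 1, key 1⟩
    | roumieu => exact fun m _ => ⟨1, fun e _ => key m e⟩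

theorem _root_.Ultra.IsDeriv.sub {α : Fin d → ℕ} {a b a' b' : E}
    (h : IsDeriv α (T.toUltra a) (T.toUltra b)) (h' : IsDeriv α (T.toUltra a') (T.toUltra b')) :
    IsDeriv α (T.toUltra (a - a')) (T.toUltra (b - b')) := by
  rw [isDeriv_iff] at h h' ⊢
  intro φ
  rw [map_sub, map_sub, sub_apply, sub_apply, h, h']
  ring

section Limits

variable {T} [CompleteSpace E] {τ C B ε m : ℝ}

/-- All derivatives fall on the kernel. Each costs a factor `ε⁻¹`, so the bound is for the index `ε
* m` when the kernel satisfies its estimates at `m`. -/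
theorem derivNorm_reg_le_norm (hτ : 0 < τ) (hC : 0 < C)
    (hg : ∀ y e, ‖T.shift y e‖ ≤ C * Real.exp (w.assoc (τ * ‖y‖)) * ‖e‖) {φ : TestSpace r w d}
    (hm : 0 < m) (hφ : ∀ α x, m ^ order α *
      (‖mderiv α φ.toFun x‖ * Real.exp (w.assoc (τ * ‖x‖))) ≤ B * w.M (order α) * jap x)
    (hε0 : 0 < ε) (hε1 : ε ≤ 1) (e : E) :
    T.derivNorm (ε * m) (T.reg φ.toFun ε e) ≤
      ENNReal.ofReal (C * B * (∫ y : Rd d, jap y) * ‖e‖) := by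
  have hdec : ∀ α, HasDecay w τ (B * w.M (order α) / m ^ order α) (mderiv α φ.toFun) := fun α =>
    ⟨(mderiv_smooth α φ.smooth).continuous, fun x => by
      rw [div_mul_eq_mul_div, le_div_iff₀ (by positivity), mul_comm]
      exact hφ α x⟩
  refine T.derivNorm_le_ofReal fun α => ⟨_, isDeriv_reg hτ hC hg φ (fun α => ⟨_, hdec α⟩) hε0 hε1
    α e, ?_⟩
  have h1 := norm_reg_le hτ hC hg (hdec α) hε0.le hε1 e
  rw [norm_smul, norm_inv, norm_pow, Complex.norm_real, Real.norm_of_nonneg hε0.le]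
  calc (ε * m) ^ order α * ((ε ^ order α)⁻¹ * ‖T.reg (mderiv α φ.toFun) ε e‖)
      = m ^ order α * ‖T.reg (mderiv α φ.toFun) ε e‖ := by
        rw [mul_pow]
        field_simp
    _ ≤ m ^ order α * (C * (B * w.M (order α) / m ^ order α) * (∫ y : Rd d, jap y) * ‖e‖) := by
        gcongr
    _ = _ := by field_simp

/-- Here the derivatives fall on `e`, so neither the index `m` nor the constant deteriorates as `ε →
0`. Positivity of `K` covers the case of infinite norm. -/
theorem derivNorm_reg_le_derivNorm (hτ : 0 < τ) (hC : 0 < C)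
    (hg : ∀ y e, ‖T.shift y e‖ ≤ C * Real.exp (w.assoc (τ * ‖y‖)) * ‖e‖) {f : Rd d → ℂ}
    (hf : HasDecay w τ B f) (hε0 : 0 ≤ ε) (hε1 : ε ≤ 1) (hm : 0 < m) {K : ℝ≥0} (hK : 0 < K)
    (hCK : C * B * (∫ y : Rd d, jap y) ≤ K) (e : E) :
    T.derivNorm m (T.reg f ε e) ≤ K * T.derivNorm m e := by
  rcases eq_or_ne (T.derivNorm m e) ⊤ with h | h
  · rw [h, ENNReal.mul_top (by exact_mod_cast hK.ne')]
    exact le_top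
  rw [← ENNReal.ofReal_toReal h, ← ENNReal.ofReal_coe_nnreal, ← ENNReal.ofReal_mul (p := (K : ℝ)) K.2]
  refine T.derivNorm_le_ofReal fun α => ?_
  obtain ⟨g, hgd, hgn⟩ := T.exists_isDeriv h.lt_top α
  refine ⟨_, isDeriv_reg_reg hτ hC hg hf hε0 hε1 hgd, ?_⟩
  calc m ^ order α * ‖T.reg f ε g‖ ≤ m ^ order α * (K * ‖g‖) := by
        have := norm_reg_le hτ hC hg hf hε0 hε1 g
        gcongr
        exact this.trans (by gcongr)
    _ = K * (m ^ order α * ‖g‖) := by ring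
    _ ≤ K * ((T.derivNorm m e).toReal * w.M (order α)) := by gcongr
    _ = _ := by ring

theorem finite_order_lt (N : ℕ) : {α : Fin d → ℕ | order α < N}.Finite := by
  refine (Set.finite_Iic (fun _ : Fin d => N)).subset fun α hα i => ?_
  have h1 : α i ≤ order α := Finset.single_le_sum (fun _ _ => Nat.zero_le _) (Finset.mem_univ i)
  exact h1.trans (le_of_lt hα)

/-- Finiteness at the index `2 * m` gives a factor `2 ^ (-order α)` at the index `m`: the orders at
least `N` are uniformly small, and for the finitely many `α` of order below `N` it remains to apply
`tendsto_reg` to each derivative. -/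
theorem tendsto_derivNorm_reg_sub (hτ : 0 < τ) (hC : 0 < C)
    (hg : ∀ y e, ‖T.shift y e‖ ≤ C * Real.exp (w.assoc (τ * ‖y‖)) * ‖e‖) {f : Rd d → ℂ}
    (hf : HasDecay w τ B f) (hf1 : ∫ y, f y = 1) {ε : ℕ → ℝ} (hε0 : ∀ n, 0 ≤ ε n)
    (hε1 : ∀ n, ε n ≤ 1) (hε : Tendsto ε atTop (𝓝 0)) (hm : 0 < m) {e : E}
    (he : T.derivNorm (2 * m) e < ⊤) :
    Tendsto (fun n => T.derivNorm m (T.reg f (ε n) e - e)) atTop (𝓝 0) := by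
  choose g hgd hgn using T.exists_isDeriv he
  set R := (T.derivNorm (2 * m) e).toReal with hR
  set K := |C * B * (∫ y : Rd d, jap y)| + 1 with hK
  have hR0 : 0 ≤ R := ENNReal.toReal_nonneg
  have hK0 : 0 < K := by positivity
  rw [ENNReal.tendsto_nhds_zero]
  intro δ' hδ'
  obtain ⟨δ, hδ, hδδ⟩ : ∃ δ : ℝ, 0 < δ ∧ ENNReal.ofReal δ ≤ δ' := by
    obtain ⟨q, hq, hqδ⟩ := ENNReal.lt_iff_exists_nnreal_btwn.1 hδ'
    exact ⟨q, by exact_mod_cast hq, by rw [ENNReal.ofReal_coe_nnreal]; exact hqδ.le⟩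
  obtain ⟨N, hN⟩ : ∃ N : ℕ, K * R * (1 / 2 : ℝ) ^ N < δ := by
    have : Tendsto (fun N : ℕ => K * R * (1 / 2 : ℝ) ^ N) atTop (𝓝 (K * R * 0)) :=
      (tendsto_pow_atTop_nhds_zero_of_lt_one (by norm_num) (by norm_num)).const_mul _
    rw [mul_zero] at this
    exact (this.eventually_lt_const hδ).exists
  have hsmall : ∀ᶠ n in atTop, ∀ α ∈ {α : Fin d → ℕ | order α < N},
      m ^ order α * ‖T.reg f (ε n) (g α) - g α‖ < δ * w.M (order α) := by
    rw [Filter.eventually_all_finite (finite_order_lt N)]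
    intro α _
    have hM := w.M_pos (order α)
    have h1 := ((tendsto_reg hτ hC hg hf hf1 hε0 hε1 hε (g α)).sub_const (g α)).norm.const_mul
      (m ^ order α)
    rw [sub_self, _root_.norm_zero, mul_zero] at h1
    exact h1.eventually_lt_const (by positivity)
  filter_upwards [hsmall] with n hn
  refine le_trans (T.derivNorm_le_ofReal fun α => ⟨_, IsDeriv.sub T
    (isDeriv_reg_reg hτ hC hg hf (hε0 n) (hε1 n) (hgd α)) (hgd α), ?_⟩) hδδ
  rcases lt_or_ge (order α) N with h | h
  · exact (hn α h).le
  have hM := w.M_pos (order α)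
  have h1 : ‖T.reg f (ε n) (g α) - g α‖ ≤ K * ‖g α‖ := by
    have := norm_reg_le hτ hC hg hf (hε0 n) (hε1 n) (g α)
    have h2 := le_abs_self (C * B * ∫ y : Rd d, jap y)
    calc ‖T.reg f (ε n) (g α) - g α‖ ≤ ‖T.reg f (ε n) (g α)‖ + ‖g α‖ := norm_sub_le _ _
      _ ≤ |C * B * ∫ y : Rd d, jap y| * ‖g α‖ + ‖g α‖ := by
        gcongr
        exact this.trans (by gcongr)
      _ = _ := by rw [hK]; ring
  have h2 := hgn α
  rw [mul_pow] at h2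
  have h3 : (1 / 2 : ℝ) ^ order α ≤ (1 / 2 : ℝ) ^ N :=
    pow_le_pow_of_le_one (by norm_num) (by norm_num) h
  have h4 : (1 / 2 : ℝ) ^ order α * 2 ^ order α = 1 := by
    rw [← mul_pow]
    norm_num
  calc m ^ order α * ‖T.reg f (ε n) (g α) - g α‖ ≤ m ^ order α * (K * ‖g α‖) := by gcongr
    _ = K * (1 / 2 : ℝ) ^ order α * (2 ^ order α * m ^ order α * ‖g α‖) := by
        linear_combination (-(K * m ^ order α * ‖g α‖)) * h4
    _ ≤ K * (1 / 2 : ℝ) ^ order α * (R * w.M (order α)) := by gcongr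
    _ ≤ K * (1 / 2 : ℝ) ^ N * (R * w.M (order α)) := by gcongr
    _ = K * R * (1 / 2 : ℝ) ^ N * w.M (order α) := by ring
    _ ≤ δ * w.M (order α) := by gcongr

end Limits

/-- If there is a nonzero test function, then the identities of `E` and of `D^*_E` are limits of
operators that factor through the other space. -/
theorem exists_regularization [CompleteSpace E] {φ₀ : TestSpace r w d} (hφ₀ : φ₀ ≠ 0) :
    ∃ S : ℕ → E →L[ℂ] T.D,
      Tendsto (fun n => Lc.sandwich T.incl (S n) (Lc.id E)) atTop (𝓝 (Lc.id T.D)) ∧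
      Tendsto (fun n => Lc.sandwich (S n) T.incl (Lc.id T.D)) atTop (𝓝 (Lc.id E)) := by
  obtain ⟨φ, hφ1⟩ := TestSpace.exists_integral_eq_one hφ₀
  obtain ⟨τ, C, hτ, hC, hg, hdec⟩ := T.exists_growth φ
  obtain ⟨B, hB⟩ : ∃ B, HasDecay w τ B φ.toFun := by
    obtain ⟨m, hm, B, hB0, hB⟩ := hdec.exists
    refine ⟨B, φ.smooth.continuous, fun x => ?_⟩
    simpa [w.M_zero] using hB 0 x
  let ε : ℕ → ℝ := fun n => 1 / ((n : ℝ) + 1)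
  have hε0 : ∀ n, 0 < ε n := fun n => by positivity
  have hε1 : ∀ n, ε n ≤ 1 := fun n => by
    rw [div_le_one (by positivity)]
    linarith [n.cast_nonneg (α := ℝ)]
  have hε : Tendsto ε atTop (𝓝 0) := tendsto_one_div_add_atTop_nhds_zero_nat
  -- The bound at `m` needs the kernel estimate at `(ε n)⁻¹ * m`. The dilation depends on `n`, which
  -- is harmless: each `S n` only has to be continuous.
  have hbound : ∀ n, ForLarge r fun m => ∃ K : ℝ≥0, ∀ e,
      T.derivNorm m (T.reg φ.toFun (ε n) e) ≤ K * ‖e‖ₑ := by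
    intro n
    refine (hdec.rescale (inv_pos.2 (hε0 n))).mono fun m hm ⟨B', hB'0, hB'⟩ => ?_
    have hJ : 0 ≤ ∫ y : Rd d, jap y := integral_nonneg jap_nonneg
    refine ⟨(C * B' * ∫ y : Rd d, jap y).toNNReal, fun e => ?_⟩
    have h1 := derivNorm_reg_le_norm hτ hC hg (mul_pos (inv_pos.2 (hε0 n)) hm) hB' (hε0 n)
      (hε1 n) e
    rw [mul_inv_cancel_left₀ (hε0 n).ne', ENNReal.ofReal_mul (by positivity), ofReal_norm] at h1
    exact h1
  let S₀ : ∀ n, E →ₗ[ℂ] T.D := fun n =>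
    { toFun := fun e => ⟨T.reg φ.toFun (ε n) e, T.derivScale.mem_carrier_of_forLarge
        ((hbound n).mono fun m _ ⟨K, hK⟩ =>
          (hK e).trans_lt (ENNReal.mul_lt_top ENNReal.coe_lt_top enorm_lt_top))⟩
      map_add' := fun a b => Subtype.ext (reg_add hτ hC hg hB (hε0 n).le (hε1 n) a b)
      map_smul' := fun c a => Subtype.ext (reg_smul _ _ c a) }
  let S : ℕ → E →L[ℂ] T.D := fun n => ⟨S₀ n, T.derivScale.continuous_of_forLarge (S₀ n) (hbound n)⟩
  refine ⟨S, ?_, ?_⟩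
  · refine Lc.tendsto_id_of_pointwise (T.derivScale.withSeminorms r) (fun q hq => ?_) fun x => ?_
    · exact T.derivScale.exists_continuous_seminorm_bound
        (A := fun n => S₀ n ∘ₗ T.incl.toLinearMap)
        -- The summand `1` makes the constant positive, so that the bound also holds where the norm
        -- is infinite.
        (C := (C * B * ∫ y : Rd d, jap y).toNNReal + 1)
        (fun m hm n x => derivNorm_reg_le_derivNorm hτ hC hg hB (hε0 n).le (hε1 n) hm
          (by positivity) ((Real.le_coe_toNNReal _).trans (by simp)) x.val) hq
    · refine T.derivScale.tendsto_of_forLarge ?_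
      refine ((T.derivScale.forLarge_norm_lt_top x).rescale two_pos).mono fun m hm hx => ?_
      exact tendsto_derivNorm_reg_sub hτ hC hg hB hφ1 (fun n => (hε0 n).le) hε1 hε hm hx
  · exact Lc.tendsto_id_of_norm_le
      (fun n x => norm_reg_le hτ hC hg hB (hε0 n).le (hε1 n) x)
      (tendsto_reg hτ hC hg hB hφ1 (fun n => (hε0 n).le) hε1 hε)

end TranslationInvariant

/-- If there are no nonzero test functions, then `E` is trivial. -/
theorem TranslationInvariant.subsingleton_of_testSpace {E : Type*} [NormedAddCommGroup E]
    [NormedSpace ℂ E] (T : TranslationInvariant r w d E) (h : ∀ φ : TestSpace r w d, φ = 0) :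
    Subsingleton E := by
  refine subsingleton_of_forall_eq 0 fun e => ?_
  refine T.denseRange_ofTest.induction_on (p := fun e => e = 0) e
    (isClosed_eq continuous_id continuous_const) fun φ => ?_
  rw [h φ, map_zero]

theorem id_mem_finiteRank_of_subsingleton (X : Type*) [AddCommGroup X] [Module ℂ X]
    [TopologicalSpace X] [IsTopologicalAddGroup X] [ContinuousSMul ℂ X] [Subsingleton X] :
    Lc.id X ∈ finiteRank X := by
  have : Lc.id X = 0 := by
    apply UniformConvergenceCLM.ext
    exact fun _ => Subsingleton.elim _ _
  rw [this]
  exact zero_mem _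

end Ultra

end

theorem mainTheorem12 {d : ℕ} (r : Ultra.Regime) (w : Ultra.WeightPair)
    {E : Type*} [NormedAddCommGroup E] [NormedSpace ℂ E] [CompleteSpace E]
    (T : Ultra.TranslationInvariant r w d E) :
    (Ultra.HasSchauderBasis E → Ultra.WeakSequentialApproximationProperty T.D) ∧
    (Ultra.WeakApproximationProperty E ↔ Ultra.WeakApproximationProperty T.D) := by
  -- The mollifier exists only if some test function is nonzero; otherwise both spaces are trivial
  -- and the identity is itself of finite rank.
  by_cases h : ∀ φ : Ultra.TestSpace r w d, φ = 0
  · have hE : Subsingleton E := T.subsingleton_of_testSpace h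
    have hD : Subsingleton T.D := ⟨fun a b => Subtype.ext (Subsingleton.elim _ _)⟩
    have h1 := Ultra.id_mem_finiteRank_of_subsingleton E
    have h2 := Ultra.id_mem_finiteRank_of_subsingleton T.D
    exact ⟨fun _ S hS => hS.1 h2, fun _ => subset_closure h2, fun _ => subset_closure h1⟩
  · push Not at h
    obtain ⟨φ, hφ⟩ := h
    obtain ⟨S, hSD, hSE⟩ := T.exists_regularization hφ
    refine ⟨fun hb => ?_, Ultra.WeakApproximationProperty.of_approx_factor hSD,
      Ultra.WeakApproximationProperty.of_approx_factor hSE⟩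
    obtain ⟨P, hP, hPid⟩ := hb.exists_finiteRank_tendsto
    exact Ultra.WeakSequentialApproximationProperty.of_approx_factor hSD hP hPid
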